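/- Let $X_G=\sum_\kappa\prod_{v\in V(G)}x_{\kappa(v)}$ (sum over all proper colorings $\kappa:V(G)\to\{1,2,3,\dots\}$) be the chromatic symmetric function of a finite simple graph $G$, and let $[s_\lambda]F$ denote the coefficient of the Schur function $s_\lambda$ in the expansion of a symmetric function $F$ (over $\mathbb{Q}$) in the basis of Schur functions; $F$ is Schur-positive if all these coefficients are nonnegative. For $N\ge 1$ let $\mathcal{S}_N$ be the poset of connected graphs on $N$ vertices, where two graphs with the same chromatic symmetric function are identified, ordered by $$G\ge_s H\iff X_G-\frac{[s_{(1^N)}]X_G}{[s_{(1^N)}]X_H}\,X_H\ \text{ is Schur-positive.}$$ For $m\ge 1$, $n\ge 0$ let the lollipop graph $L_{m,n}$ be the graph on the vertices $1,\dots,m+n$ consisting of a complete graph on $\{1,\dots,m\}$ together with the edges between $i$ and $i+1$ for $m\le i\le m+n-1$. Theorem. For every $N\ge 1$, the family of lollipop graphs $L_{m,n}$ with $m\ge 1$, $n\ge 0$ and $m+n=N$ forms a chain in $\mathcal{S}_N$: any two of them are comparable. In particular, for all $m\ge 3$ and $n\ge 0$ with $m+n=N$, $$L_{m-1,n+1}\ge_s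 L_{m,n}.$$ Hence the path $P_N$ is the maximum and the complete graph $K_N$ is the minimum of this chain. -/

import Mathlib

noncomputable section

namespace ChromaticSchur

/-! ### Symmetric functions, inside the power series ring `ℚ⟦x₀, x₁, x₂, …⟧` -/

/-- Formal power series with rational coefficients in countably many commuting variables.
The variables are indexed by `ℕ` instead of the positive integers. -/
abbrev Series : Type := MvPowerSeries ℕ ℚ

/-- The elementary symmetric function `e_k`: the sum of all squarefree monomials of degree `k`
(so `e_0 = 1`). -/
def elem (k : ℕ) : Series := fun d =>
  open Classical in if (∀ i, d i ≤ 1) ∧ d.degree = k then 1 else 0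

/-- `e_k` for an integer `k`, with `e_k = 0` for `k < 0`. -/
def elemInt : ℤ → Series
  | Int.ofNat k => elem k
  | Int.negSucc _ => 0

/-- The Schur function `s_μ = det (e_{μᵗ_i - i + j})`, with `1 ≤ i, j ≤ μ_1`. Partitions are
represented by their Young diagrams: `μ.rowLen 0` is the largest part of `μ`, and `μ.colLen i` is
the `i`-th part (counted from `0`) of the transpose of `μ`. -/
def schur (μ : YoungDiagram) : Series :=
  Matrix.det (Matrix.of fun i j : Fin (μ.rowLen 0) =>
    elemInt ((μ.colLen i : ℤ) - ((i : ℕ) : ℤ) + ((j : ℕ) : ℤ)))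

/-- `c` lists the coefficients of an expansion `F = ∑_μ c_μ s_μ` (a finite sum). -/
def IsSchurExpansion (F : Series) (c : YoungDiagram →₀ ℚ) : Prop :=
  F = c.sum fun μ a => a • schur μ

/-- The coefficient `[s_μ] F` of `s_μ` in the expansion of `F` in Schur functions. The Schur
functions are linearly independent, so there is at most one expansion; the value is `0` if `F` is
not a linear combination of Schur functions, that is, not a symmetric function. -/
def schurCoeff (μ : YoungDiagram) (F : Series) : ℚ :=
  open Classical in
  if h : ∃ c : YoungDiagram →₀ ℚ, IsSchurExpansion F c then h.choose μ else 0

/-- `F` is a linear combination of Schur functions with nonnegative coefficients. -/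
def IsSchurPositive (F : Series) : Prop :=
  ∃ c : YoungDiagram →₀ ℚ, (∀ μ, 0 ≤ c μ) ∧ IsSchurExpansion F c

/-- The Young diagram of the partition `(1^n) = (1, 1, …, 1)` of `n`. -/
def column (n : ℕ) : YoungDiagram where
  cells := Finset.range n ×ˢ {0}
  isLowerSet := by
    rintro ⟨a, b⟩ ⟨c, d⟩ ⟨h₁, h₂⟩ h
    simp only [Finset.coe_product, Finset.coe_range, Finset.coe_singleton, Set.mem_prod,
      Set.mem_Iio, Set.mem_singleton_iff] at h h₁ h₂ ⊢
    omega

/-- The chromatic symmetric function `X_G = ∑_κ ∏_v x_{κ(v)}`, summed over all proper colorings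
`κ` of `G`: the coefficient of a monomial is the (finite) number of proper colorings that
contribute it. -/
def chromaticSymm {V : Type} [Fintype V] (G : SimpleGraph V) : Series := fun d =>
  (Nat.card {κ : G.Coloring ℕ // ∑ v, Finsupp.single (κ v) 1 = d} : ℚ)

/-! ### The Schur-positivity poset -/

/-- A connected simple graph on `N` vertices. -/
structure ConnGraph (N : ℕ) : Type 1 where
  /-- The vertices. -/
  V : Type
  /-- There are finitely many vertices. -/
  [fintype : Fintype V]
  /-- The graph. -/
  graph : SimpleGraph V
  card_eq : Fintype.card V = N
  connected : graph.Connected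

attribute [instance] ConnGraph.fintype

/-- The chromatic symmetric function of a connected graph on `N` vertices. -/
def ConnGraph.X {N : ℕ} (G : ConnGraph N) : Series := chromaticSymm G.graph

/-- The weighted difference `X_s(G, H) = X_G - ([s_{(1^N)}] X_G / [s_{(1^N)}] X_H) X_H`. -/
def schurDiff {N : ℕ} (G H : ConnGraph N) : Series :=
  G.X - (schurCoeff (column N) G.X / schurCoeff (column N) H.X) • H.X

/-- Two graphs are identified if they have the same chromatic symmetric function. -/
instance connGraphSetoid (N : ℕ) : Setoid (ConnGraph N) where
  r G H := G.X = H.X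
  iseqv := ⟨fun _ => rfl, fun h => h.symm, fun h h' => h.trans h'⟩

/-- The equivalence classes of connected graphs on `N` vertices; with the relation `≤` below this
is the Schur-positivity poset `S_N`. -/
def SchurPoset (N : ℕ) : Type 1 := Quotient (connGraphSetoid N)

/-- The class of a connected graph. -/
def ConnGraph.cls {N : ℕ} (G : ConnGraph N) : SchurPoset N := Quotient.mk (connGraphSetoid N) G

/-- The order of `S_N`: `H ≤ G` if and only if `X_s(G, H)` is Schur-positive. -/
instance (N : ℕ) : LE (SchurPoset N) where
  le := Quotient.lift₂ (fun H G => IsSchurPositive (schurDiff G H)) (by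
    intro H G H' G' hH hG
    have hH' : H.X = H'.X := hH
    have hG' : G.X = G'.X := hG
    simp only [schurDiff, hH', hG'])

/-! ### Lollipops, paths and complete graphs -/

/-- The lollipop `L_{m,n}` on `m + n` vertices, labelled here by `0, …, m + n - 1`: a complete
graph on the first `m` vertices, and a path through the last of these and the `n` vertices that
follow (edges between `i` and `i + 1` for `m - 1 ≤ i`). -/
def lollipop (m n : ℕ) : SimpleGraph (Fin (m + n)) where
  Adj i j := (i ≠ j ∧ i.val < m ∧ j.val < m) ∨ (m ≤ i.val + 1 ∧ j.val = i.val + 1) ∨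
    (m ≤ j.val + 1 ∧ i.val = j.val + 1)
  symm := ⟨by
    rintro i j (⟨h, hi, hj⟩ | h | h)
    · exact Or.inl ⟨h.symm, hj, hi⟩
    · exact Or.inr (Or.inr h)
    · exact Or.inr (Or.inl h)⟩
  loopless := ⟨by
    rintro i (⟨h, -⟩ | ⟨-, h⟩ | ⟨-, h⟩)
    · exact h rfl
    · omega
    · omega⟩

theorem pathGraph_connected_of_pos {N : ℕ} (hN : 1 ≤ N) : (SimpleGraph.pathGraph N).Connected := by
  obtain ⟨k, rfl⟩ : ∃ k, N = k + 1 := ⟨N - 1, by omega⟩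
  exact SimpleGraph.pathGraph_connected k

theorem lollipop_connected {m n : ℕ} (hm : 1 ≤ m) : (lollipop m n).Connected := by
  refine (pathGraph_connected_of_pos (N := m + n) (by omega)).mono ?_
  intro i j h
  rw [SimpleGraph.pathGraph_adj] at h
  simp only [lollipop, ne_eq, Fin.ext_iff]
  omega

/-- The class of `L_{m,n}` in `S_N`, where `m ≥ 1` and `m + n = N`. -/
def lollipopClass {N : ℕ} (m n : ℕ) (hm : 1 ≤ m) (h : m + n = N) : SchurPoset N :=
  ConnGraph.cls
    { V := Fin (m + n)
      graph := lollipop m n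
      card_eq := by rw [Fintype.card_fin, h]
      connected := lollipop_connected hm }

/-- The class of the path `P_N` in `S_N`. -/
def pathClass (N : ℕ) (hN : 1 ≤ N) : SchurPoset N :=
  ConnGraph.cls
    { V := Fin N
      graph := SimpleGraph.pathGraph N
      card_eq := Fintype.card_fin N
      connected := pathGraph_connected_of_pos hN }

/-- The class of the complete graph `K_N` in `S_N`. -/
def completeClass (N : ℕ) (hN : 1 ≤ N) : SchurPoset N :=
  ConnGraph.cls
    { V := Fin N
      graph := ⊤
      card_eq := Fintype.card_fin N
      connected := (pathGraph_connected_of_pos hN).mono le_top }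

/-- The set of the classes of all lollipops on `N` vertices. -/
def lollipops (N : ℕ) : Set (SchurPoset N) :=
  {x | ∃ (m n : ℕ) (hm : 1 ≤ m) (h : m + n = N), x = lollipopClass m n hm h}

end ChromaticSchur

end

/-! Write `P_N` for the chromatic function of the path. In a proper coloring of a clique and a
disjoint path, at most one clique vertex has the color of the first path vertex. Counting such
colorings gives `lollipopX_recursion`: `X_{L_{k+1,n}} = k X_{L_{k,n+1}} - (k-1) k! e_k P_{n+1}`.
Unrolled, this expresses every lollipop by paths, and the case of complete graphs becomes `∑ (l-1)
e_l P_{N-l} = -e_N` (`pathX_recursion`).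

The coefficient of `s_(1^N)` is read off by the homomorphism `e_k ↦ X^k`, which kills every Schur
function with two or more columns. For `L_{m,n}` it is `m! 2^n`. Hence the weighted difference of
`L_{k,n+1}` and `L_{k+1,n}` is a nonnegative multiple of `D_N = 2k e_k P_{N-k} + ∑_{j<k} (j-1) e_j
P_{N-j}` with `N = k+n+1` (`cliquePathDiff`).

As generating functions, `D` agrees from degree `k` on with a product `A P`, so the path recursion
yields a recursion for `D` (`cliquePathDiff_eq`): nonnegative multiples of `e_i D_l` with `l < N`,
plus a quadratic expression in the `e_i`. The latter is a nonnegative combination of differences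
`e_a e_b - e_l e_{a+b-l}` with `l` farther from the middle, each a sum of two-column Schur
functions. Since multiplication by `e_i` preserves Schur-positivity by the Pieri rule, proved here
with determinants, induction on `N` finishes the adjacent case. Arbitrary pairs follow by
transitivity. -/

noncomputable section

namespace ChromaticSchur

open Finset PowerSeries

/-! ### The Pieri rule for Jacobi–Trudi determinants. -/

section JacobiTrudi

variable {R : Type*} [CommRing R]

/-- The Jacobi–Trudi determinant `det (h (f i - i + j))`. -/
def jacobiTrudi (h : ℤ → R) {n : ℕ} (f : Fin n → ℕ) : R :=
  Matrix.det (Matrix.of fun i j : Fin n => h ((f i : ℤ) - ((i : ℕ) : ℤ) + ((j : ℕ) : ℤ)))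

/-- The tail generating function `∑_b h (m + b) X ^ b`. -/
def tailSeries (h : ℤ → R) (m : ℤ) : R⟦X⟧ := PowerSeries.mk fun b => h (m + b)

/-- The part of `tailSeries` of degree less than `k`. -/
def tailTrunc (h : ℤ → R) (k : ℕ) (m : ℤ) : R⟦X⟧ :=
  ∑ b ∈ range k, (X : R⟦X⟧) ^ b * C (h (m + b))

theorem tailSeries_eq_tailTrunc_add (h : ℤ → R) (k : ℕ) (m : ℤ) :
    tailSeries h m = tailTrunc h k m + X ^ k * tailSeries h (m + k) := by
  ext d
  simp only [tailSeries, tailTrunc, map_add, map_sum, coeff_mk, coeff_X_pow_mul', coeff_C]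
  rw [Finset.sum_congr rfl (g := fun b => if d = b then h (m + d) else 0)]
  · rw [Finset.sum_ite_eq (range k) d]
    by_cases hd : d < k
    · simp [hd]
    · simp only [mem_range, hd, if_false, zero_add, if_pos (not_lt.1 hd)]
      congr 1
      push_cast [not_lt.1 hd]
      ring
  · intro b _
    by_cases h1 : d = b
    · subst h1; simp
    · by_cases h2 : b ≤ d
      · rw [if_pos h2, if_neg (by omega), if_neg h1]
      · rw [if_neg h2, if_neg h1]

theorem tailSeries_eq_add_X_mul (h : ℤ → R) (m : ℤ) :
    tailSeries h m = C (h m) + X * tailSeries h (m + 1) := by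
  simpa [tailTrunc] using tailSeries_eq_tailTrunc_add h 1 m

/-- If the last index vanishes, the determinant of tail series is a product, by column
operations. -/
theorem det_tailSeries {h : ℤ → R} (hneg : ∀ m < 0, h m = 0) {n : ℕ} (f : Fin (n + 1) → ℕ)
    (hf : f (Fin.last n) = 0) :
    Matrix.det (Matrix.of fun i j : Fin (n + 1) =>
        tailSeries h ((f i : ℤ) - ((i : ℕ) : ℤ) + ((j : ℕ) : ℤ))) =
      tailSeries h 0 * C (jacobiTrudi h fun i : Fin n => f i.castSucc) := by
  set A : Matrix (Fin (n + 1)) (Fin (n + 1)) R⟦X⟧ := Matrix.of fun i j =>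
    tailSeries h ((f i : ℤ) - ((i : ℕ) : ℤ) + ((j : ℕ) : ℤ)) with hA
  set B : Matrix (Fin (n + 1)) (Fin (n + 1)) R⟦X⟧ := Matrix.of fun i j =>
    if j = Fin.last n then tailSeries h ((f i : ℤ) - ((i : ℕ) : ℤ) + ((j : ℕ) : ℤ))
    else C (h ((f i : ℤ) - ((i : ℕ) : ℤ) + ((j : ℕ) : ℤ))) with hB
  have hAB : A.det = B.det := by
    -- Each column loses `X` times its right neighbor and becomes constant. The available lemma uses
    -- the preceding column, hence the reversal.
    have key : (A.submatrix id Fin.revPerm).det = (B.submatrix id Fin.revPerm).det := by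
      refine Matrix.det_eq_of_forall_col_eq_smul_add_pred (fun _ => X) (fun i => ?_)
        (fun i j => ?_)
      · simp [hA, hB]
      · have h1 : Fin.rev j.succ ≠ Fin.last n := by
          rw [Fin.rev_succ]; exact (Fin.castSucc_lt_last _).ne
        simp only [hA, hB, Matrix.submatrix_apply, Matrix.of_apply, id_eq, Fin.revPerm_apply,
          if_neg h1]
        rw [tailSeries_eq_add_X_mul, Fin.rev_succ, Fin.rev_castSucc]
        simp only [Fin.val_castSucc, Fin.val_succ]
        push_cast
        simp only [add_assoc]
    rw [Matrix.det_permute', Matrix.det_permute'] at key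
    have hu : IsUnit (((Equiv.Perm.sign (Fin.revPerm : Equiv.Perm (Fin (n + 1))) : ℤˣ) : ℤ) :
        R⟦X⟧) := by
      rcases Int.units_eq_one_or (Equiv.Perm.sign (Fin.revPerm : Equiv.Perm (Fin (n + 1)))) with
        h1 | h1 <;> simp [h1]
    exact hu.mul_left_cancel key
  rw [hAB, Matrix.det_succ_row B (Fin.last n), Finset.sum_eq_single (Fin.last n)]
  · have e1 : B (Fin.last n) (Fin.last n) = tailSeries h 0 := by simp [hB, hf]
    have e2 : B.submatrix (Fin.last n).succAbove (Fin.last n).succAbove =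
        (C (R := R)).mapMatrix (Matrix.of fun i j : Fin n =>
          h ((f i.castSucc : ℤ) - ((i : ℕ) : ℤ) + ((j : ℕ) : ℤ))) := by
      ext1 i j
      simp [hB, (Fin.castSucc_lt_last j).ne]
    rw [e1, e2, ← RingHom.map_det, jacobiTrudi, ← two_mul, pow_mul]
    simp
  · intro j _ hj
    have : (j : ℕ) < n := Fin.val_lt_last hj
    have e1 : B (Fin.last n) j = 0 := by
      simp only [hB, Matrix.of_apply, if_neg hj, hf, Fin.val_last]
      rw [hneg _ (by push_cast; omega), map_zero]
    rw [e1]; simp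
  · simp

/-- The bound of the `i`-th entry in a horizontal strip that is added to `f`, with the bound `k`
for the first entry. -/
def stripBound (k : ℕ) {n : ℕ} (f : Fin (n + 1) → ℕ) : Fin (n + 1) → ℕ :=
  Fin.cons (k + 1) fun i : Fin n => f i.castSucc - f i.succ + 1

/-- Subtracting from each row a power of `X` times the row above truncates it exactly at the
horizontal strip bound. The first row has no row above it and is cut at degree `k`, which causes the
error term. -/
theorem det_tailTrunc_rows (h : ℤ → R) {n : ℕ} (k : ℕ) (f : Fin (n + 1) → ℕ) (hf : Antitone f) :
    ∃ S : R⟦X⟧, Matrix.det (Matrix.of fun i j : Fin (n + 1) =>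
        tailSeries h ((f i : ℤ) - ((i : ℕ) : ℤ) + ((j : ℕ) : ℤ))) =
      Matrix.det (Matrix.of fun i j : Fin (n + 1) =>
        tailTrunc h (stripBound k f i) ((f i : ℤ) - ((i : ℕ) : ℤ) + ((j : ℕ) : ℤ))) +
        X ^ (k + 1) * S := by
  set T : Matrix (Fin (n + 1)) (Fin (n + 1)) R⟦X⟧ := Matrix.of fun i j =>
        tailTrunc h (stripBound k f i) ((f i : ℤ) - ((i : ℕ) : ℤ) + ((j : ℕ) : ℤ)) with hT
  set A : Matrix (Fin (n + 1)) (Fin (n + 1)) R⟦X⟧ := Matrix.of fun i j =>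
    tailSeries h ((f i : ℤ) - ((i : ℕ) : ℤ) + ((j : ℕ) : ℤ)) with hA
  have h1 : A.det = (T.updateRow 0 (A 0)).det := by
    -- A shift by `f i.castSucc - f i.succ + 1` carries the indices of row `i.succ` to those of row
    -- `i.castSucc`; the `1` compensates for the row number.
    refine Matrix.det_eq_of_forall_row_eq_smul_add_pred
      (fun i => X ^ (f i.castSucc - f i.succ + 1)) (fun j => by simp) (fun i j => ?_)
    have hle : f i.succ ≤ f i.castSucc := hf (Fin.castSucc_lt_succ).le
    rw [Matrix.updateRow_ne (Fin.succ_ne_zero i)]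
    simp only [hA, hT, Matrix.of_apply]
    rw [tailSeries_eq_tailTrunc_add h (stripBound k f i.succ)]
    simp only [stripBound, Fin.cons_succ, Fin.val_succ, Fin.val_castSucc]
    congr 3
    push_cast [hle]
    ring
  have h2 : A 0 = T 0 + (X : R⟦X⟧) ^ (k + 1) • fun j : Fin (n + 1) =>
      tailSeries h (((f 0 : ℤ) + ((j : ℕ) : ℤ)) + (k + 1 : ℕ)) := by
    ext1 j
    simp only [hA, hT, Matrix.of_apply, Pi.add_apply, Pi.smul_apply, smul_eq_mul]
    rw [tailSeries_eq_tailTrunc_add h (k + 1)]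
    simp [stripBound]
  rw [h1, h2, Matrix.det_updateRow_add, Matrix.det_updateRow_smul, Matrix.updateRow_eq_self]
  exact ⟨_, rfl⟩

/-- Multilinearity in the rows: `b i` is the degree of the term chosen in row `i`. -/
theorem det_tailTrunc (h : ℤ → R) {n : ℕ} (s : Fin n → ℕ) (f : Fin n → ℕ) :
    Matrix.det (Matrix.of fun i j : Fin n =>
        tailTrunc h (s i) ((f i : ℤ) - ((i : ℕ) : ℤ) + ((j : ℕ) : ℤ))) =
      ∑ b ∈ Fintype.piFinset fun i => range (s i),
        X ^ (∑ i, b i) * C (jacobiTrudi h fun i => f i + b i) := by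
  have e : (Matrix.of fun i j : Fin n =>
        tailTrunc h (s i) ((f i : ℤ) - ((i : ℕ) : ℤ) + ((j : ℕ) : ℤ))) =
      fun i => ∑ b ∈ range (s i), (X : R⟦X⟧) ^ b • fun j : Fin n =>
        C (h (((f i + b : ℕ) : ℤ) - ((i : ℕ) : ℤ) + ((j : ℕ) : ℤ))) := by
    funext i j
    simp only [Matrix.of_apply, tailTrunc, Finset.sum_apply, Pi.smul_apply, smul_eq_mul]
    refine Finset.sum_congr rfl fun b _ => ?_
    congr 3
    push_cast; ring
  have e' := MultilinearMap.map_sum_finset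
    (Matrix.detRowAlternating (n := Fin n) (R := R⟦X⟧)).toMultilinearMap
    (fun i b => (X : R⟦X⟧) ^ b • fun j : Fin n =>
        C (h (((f i + b : ℕ) : ℤ) - ((i : ℕ) : ℤ) + ((j : ℕ) : ℤ)))) (fun i => range (s i))
  rw [e]
  refine e'.trans (Finset.sum_congr rfl fun b _ => ?_)
  rw [MultilinearMap.map_smul_univ, Finset.prod_pow_eq_pow_sum, smul_eq_mul, jacobiTrudi,
    RingHom.map_det]
  rfl

/-- The Pieri rule for Jacobi–Trudi determinants. -/
theorem mul_jacobiTrudi {h : ℤ → R} (hneg : ∀ m < 0, h m = 0) {n : ℕ} (k : ℕ)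
    (f : Fin (n + 1) → ℕ) (hf : Antitone f) (hlast : f (Fin.last n) = 0) :
    h k * jacobiTrudi h (fun i : Fin n => f i.castSucc) =
      ∑ b ∈ Fintype.piFinset fun i => range (stripBound k f i),
        if ∑ i, b i = k then jacobiTrudi h (fun i => f i + b i) else 0 := by
  obtain ⟨S, hS⟩ := det_tailTrunc_rows h k f hf
  rw [det_tailSeries hneg f hlast, det_tailTrunc] at hS
  have := congrArg (coeff k) hS
  rw [coeff_mul_C, map_add, coeff_X_pow_mul', if_neg (by omega), add_zero, map_sum] at this
  simp only [tailSeries, coeff_mk, zero_add] at this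
  rw [this]
  refine Finset.sum_congr rfl fun b _ => ?_
  rw [coeff_mul_C, coeff_X_pow]
  by_cases hb : ∑ i, b i = k
  · simp [hb]
  · rw [if_neg (Ne.symm hb), if_neg hb, zero_mul]

/-- The last row is `(0, …, 0, 1)`. Thus zero parts may be appended freely, and the number of rows
need not match the partition. -/
theorem jacobiTrudi_castSucc {h : ℤ → R} (hneg : ∀ m < 0, h m = 0) (h0 : h 0 = 1) {n : ℕ}
    (f : Fin (n + 1) → ℕ) (hlast : f (Fin.last n) = 0) :
    jacobiTrudi h f = jacobiTrudi h fun i : Fin n => f i.castSucc := by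
  rw [jacobiTrudi, Matrix.det_succ_row _ (Fin.last n), Finset.sum_eq_single (Fin.last n)]
  · simp only [Matrix.of_apply, hlast, Fin.val_last, ← two_mul, pow_mul]
    simp only [even_two, Even.neg_pow, one_pow, Nat.cast_zero, zero_sub, neg_add_cancel, h0,
      mul_one, one_mul, jacobiTrudi]
    congr 1
    ext1 i j
    simp
  · intro j _ hj
    have : (j : ℕ) < n := Fin.val_lt_last hj
    simp only [Matrix.of_apply, hlast, Fin.val_last]
    rw [hneg _ (by push_cast; omega)]
    simp
  · simp

end JacobiTrudi

end ChromaticSchur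

end

noncomputable section

namespace ChromaticSchur

open Finset

/-! ### Schur-positivity and its stability under multiplication by `e_k`. -/

theorem exists_youngDiagram_colLen {n : ℕ} (f : ℕ → ℕ) (hf : Antitone f) (hn : f n = 0) :
    ∃ μ : YoungDiagram, ∀ j, μ.colLen j = f j := by
  refine ⟨⟨(range (f 0) ×ˢ range n).filter fun c => c.1 < f c.2, ?_⟩, fun j => ?_⟩
  · rintro ⟨a, b⟩ ⟨c, d⟩ ⟨h₁, h₂⟩ h
    simp only [coe_filter, mem_product, mem_range, Set.mem_ofPred_eq] at h h₁ h₂ ⊢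
    have := hf h₂
    omega
  · refine Nat.le_antisymm (le_of_forall_lt fun i hi => ?_) (le_of_forall_lt fun i hi => ?_)
    · rw [← YoungDiagram.mem_iff_lt_colLen, ← YoungDiagram.mem_cells] at hi
      simpa using (Finset.mem_filter.1 hi).2
    · rw [← YoungDiagram.mem_iff_lt_colLen, ← YoungDiagram.mem_cells]
      have h1 : j < n := by
        by_contra hj
        have := hf (not_lt.1 hj)
        omega
      have h2 := hf (Nat.zero_le j)
      simp only [mem_filter, mem_product, mem_range]
      omega

theorem elemInt_natCast (k : ℕ) : elemInt k = elem k := rfl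

theorem elemInt_of_neg (m : ℤ) (hm : m < 0) : elemInt m = 0 := by
  cases m with
  | ofNat k => exact absurd hm (by simp)
  | negSucc k => rfl

theorem elem_zero : elem 0 = 1 := by
  classical
  refine MvPowerSeries.ext fun d => ?_
  rw [MvPowerSeries.coeff_one]
  change (if _ then _ else _) = _
  by_cases hd : d = 0
  · subst hd; simp
  · rw [if_neg hd, if_neg]
    rintro ⟨-, h⟩
    exact hd ((Finsupp.degree_eq_zero_iff d).1 h)

theorem colLen_eq_zero {μ : YoungDiagram} {j : ℕ} (hj : μ.rowLen 0 ≤ j) : μ.colLen j = 0 := by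
  by_contra h
  have := YoungDiagram.mem_iff_lt_rowLen.1
    (YoungDiagram.mem_iff_lt_colLen.2 (Nat.pos_of_ne_zero h))
  omega

theorem jacobiTrudi_colLen {μ : YoungDiagram} {n : ℕ} (hn : μ.rowLen 0 ≤ n) :
    jacobiTrudi elemInt (fun i : Fin n => μ.colLen i) = schur μ := by
  induction n, hn using Nat.le_induction with
  | base => rfl
  | succ n hn ih =>
    rw [jacobiTrudi_castSucc elemInt_of_neg elem_zero]
    · exact ih
    · exact colLen_eq_zero hn

theorem isSchurPositive_schur (μ : YoungDiagram) : IsSchurPositive (schur μ) :=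
  ⟨Finsupp.single μ 1, fun ν => by
    classical
    rw [Finsupp.single_apply]; split_ifs <;> simp,
    by simp [IsSchurExpansion, Finsupp.sum_single_index]⟩

theorem IsSchurPositive.add {F G : Series} (hF : IsSchurPositive F) (hG : IsSchurPositive G) :
    IsSchurPositive (F + G) := by
  obtain ⟨c, hc, hF⟩ := hF
  obtain ⟨d, hd, hG⟩ := hG
  refine ⟨c + d, fun μ => add_nonneg (hc μ) (hd μ), ?_⟩
  rw [IsSchurExpansion] at *
  rw [Finsupp.sum_add_index' (by simp) (by simp [add_smul]), ← hF, ← hG]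

theorem IsSchurPositive.smul {F : Series} (hF : IsSchurPositive F) {a : ℚ} (ha : 0 ≤ a) :
    IsSchurPositive (a • F) := by
  obtain ⟨c, hc, hF⟩ := hF
  refine ⟨a • c, fun μ => mul_nonneg ha (hc μ), ?_⟩
  rw [IsSchurExpansion] at *
  rw [Finsupp.sum_smul_index' (by simp), hF, Finsupp.smul_sum]
  simp [smul_smul]

theorem isSchurPositive_zero : IsSchurPositive 0 :=
  ⟨0, by simp, by simp [IsSchurExpansion]⟩

theorem isSchurPositive_sum {ι : Type*} (s : Finset ι) (F : ι → Series)
    (h : ∀ i ∈ s, IsSchurPositive (F i)) : IsSchurPositive (∑ i ∈ s, F i) :=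
  Finset.sum_induction F _ (fun _ _ => .add) isSchurPositive_zero h

theorem isSchurPositive_jacobiTrudi {n : ℕ} (f : Fin n → ℕ) (hf : Antitone f) :
    IsSchurPositive (jacobiTrudi elemInt f) := by
  obtain ⟨μ, hμ⟩ := exists_youngDiagram_colLen (n := n)
    (fun j => if h : j < n then f ⟨j, h⟩ else 0)
    (fun i j hij => by
      dsimp only
      split_ifs with h1 h2
      · exact hf hij
      · omega
      · exact Nat.zero_le _
      · exact le_rfl) (by simp)
  have h1 : μ.rowLen 0 ≤ n := by
    by_contra h
    have := YoungDiagram.mem_iff_lt_colLen.1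
      (YoungDiagram.mem_iff_lt_rowLen.2 (not_le.1 h) : (0, n) ∈ μ)
    simp [hμ] at this
  have h2 : f = fun i : Fin n => μ.colLen i := by
    funext i
    simp [hμ]
  rw [h2, jacobiTrudi_colLen h1]
  exact isSchurPositive_schur μ

theorem isSchurPositive_elem_mul_schur (k : ℕ) (μ : YoungDiagram) :
    IsSchurPositive (elem k * schur μ) := by
  -- One extra, empty column is admitted, since a vertical strip can add at most one new column.
  have h := mul_jacobiTrudi elemInt_of_neg k (fun i : Fin (μ.rowLen 0 + 1) => μ.colLen i)
    (fun i j hij => μ.colLen_anti _ _ hij) (colLen_eq_zero le_rfl)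
  rw [elemInt_natCast] at h
  change elem k * jacobiTrudi elemInt (fun i : Fin (μ.rowLen 0) => μ.colLen i) = _ at h
  rw [jacobiTrudi_colLen le_rfl] at h
  rw [h]
  refine isSchurPositive_sum _ _ fun b hb => ?_
  split_ifs with hk
  · refine isSchurPositive_jacobiTrudi _ (Fin.antitone_iff_succ_le.2 fun i => ?_)
    have hi := Fintype.mem_piFinset.1 hb i.succ
    simp only [stripBound, Fin.cons_succ, mem_range, Fin.val_castSucc, Fin.val_succ] at hi ⊢
    have := μ.colLen_anti i (i + 1) (by omega)
    omega
  · exact isSchurPositive_zero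

theorem IsSchurPositive.elem_mul {F : Series} (hF : IsSchurPositive F) (k : ℕ) :
    IsSchurPositive (elem k * F) := by
  obtain ⟨c, hc, hF⟩ := hF
  rw [IsSchurExpansion] at hF
  rw [hF, Finsupp.sum, Finset.mul_sum]
  refine isSchurPositive_sum _ _ fun μ _ => ?_
  rw [mul_smul_comm]
  exact (isSchurPositive_elem_mul_schur k μ).smul (hc μ)

theorem isSchurPositive_one : IsSchurPositive 1 := by
  simpa [jacobiTrudi] using isSchurPositive_jacobiTrudi (Fin.elim0 : Fin 0 → ℕ)
    (fun i => i.elim0)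

theorem isSchurPositive_elem (k : ℕ) : IsSchurPositive (elem k) := by
  simpa using isSchurPositive_one.elem_mul k

/-! ### Quadratic expressions in the elementary symmetric functions. -/

/-- `e_i e_{j+1} - e_{i+1} e_j` is a Schur function with at most two columns if `j < i`. -/
theorem isSchurPositive_two_column {i j : ℕ} (h : j < i) :
    IsSchurPositive (elem i * elem (j + 1) - elem (i + 1) * elem j) := by
  have := isSchurPositive_jacobiTrudi ![i, j + 1]
    (Fin.antitone_iff_succ_le.2 fun a => by fin_cases a; simpa using h)
  rw [jacobiTrudi, Matrix.det_fin_two] at this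
  have e1 : (i : ℤ) + 1 = ((i + 1 : ℕ) : ℤ) := by push_cast; ring
  have e2 : (j : ℤ) + 1 = ((j + 1 : ℕ) : ℤ) := by push_cast; ring
  simp only [Matrix.of_apply, Matrix.cons_val_zero, Matrix.cons_val_one, Fin.val_zero, Fin.val_one,
    Nat.cast_zero, Nat.cast_one, sub_zero, add_zero, sub_add_cancel, e1] at this
  rwa [← e2, add_sub_cancel_right, e2] at this

/-- Moving two indices of a product `e_i e_j` towards each other increases it. -/
theorem isSchurPositive_elem_mul_sub {i j : ℕ} (h : i ≤ j) (d : ℕ) (hd : 2 * d ≤ j - i) :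
    IsSchurPositive (elem (i + d) * elem (j - d) - elem i * elem j) := by
  induction d with
  | zero => simpa using isSchurPositive_zero
  | succ d ih =>
    have h1 := ih (by omega)
    have h2 := isSchurPositive_two_column (i := j - (d + 1)) (j := i + d) (by omega)
    have e : j - (d + 1) + 1 = j - d := by omega
    rw [e] at h2
    convert h1.add h2 using 1
    rw [← add_assoc]
    ring

/-- The series `(j - 1) e_j`. -/
def shiftedElem (j : ℕ) : Series := ((j : ℚ) - 1) • elem j

theorem sum_range_sub_two_mul (N c : ℕ) :
    ∑ l ∈ range c, ((N : ℚ) - 2 * l) = c * (N - c + 1) := by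
  induction c with
  | zero => simp
  | succ c ih => rw [sum_range_succ, ih]; push_cast; ring

/-- The reflection `l ↦ a + b - l` preserves the range and the product but negates the coefficient.
-/
theorem sum_Ico_elem_mul_eq_zero (a b : ℕ) :
    ∑ l ∈ Ico b (a + 1), (((a + b : ℕ) : ℚ) - 2 * l) • (elem l * elem (a + b - l)) = 0 := by
  have key : ∑ l ∈ Ico b (a + 1), (((a + b : ℕ) : ℚ) - 2 * l) • (elem l * elem (a + b - l)) =
      -∑ l ∈ Ico b (a + 1), (((a + b : ℕ) : ℚ) - 2 * l) • (elem l * elem (a + b - l)) := by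
    rw [← Finset.sum_neg_distrib]
    refine Finset.sum_nbij' (fun l => a + b - l) (fun l => a + b - l) ?_ ?_ ?_ ?_ ?_
    · intro l hl; rw [mem_Ico] at *; omega
    · intro l hl; rw [mem_Ico] at *; omega
    · intro l hl; rw [mem_Ico] at hl; omega
    · intro l hl; rw [mem_Ico] at hl; omega
    · intro l hl
      rw [mem_Ico] at hl
      rw [← neg_smul, mul_comm (elem l), Nat.sub_sub_self (by omega)]
      congr 1
      push_cast [show l ≤ a + b by omega]
      ring
  rw [eq_neg_iff_add_eq_zero, ← two_smul ℚ] at key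
  exact (smul_eq_zero.1 key).resolve_left two_ne_zero

/-- A quadratic combination of elementary symmetric functions that is Schur-positive. -/
theorem isSchurPositive_quadratic (a b : ℕ) :
    IsSchurPositive ((((a : ℚ) + 1) * b) • (elem a * elem b) -
      ∑ l ∈ range (a + 1), (((a + b : ℕ) : ℚ) - 2 * l) • (elem l * elem (a + b - l))) := by
  rcases le_or_gt a b with hab | hab
  -- The factor `(a + 1) b` is the sum of the weights `a + b - 2l`, so each weight can be paired
  -- with its own copy of `e_a e_b`.
  · have e : (((a : ℚ) + 1) * b) • (elem a * elem b) =
        ∑ l ∈ range (a + 1), (((a + b : ℕ) : ℚ) - 2 * l) • (elem a * elem b) := by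
      rw [← Finset.sum_smul, sum_range_sub_two_mul]
      congr 1
      push_cast
      ring
    rw [e, ← Finset.sum_sub_distrib]
    refine isSchurPositive_sum _ _ fun l hl => ?_
    rw [mem_range] at hl
    rw [← smul_sub]
    have h := isSchurPositive_elem_mul_sub (i := l) (j := a + b - l) (by omega) (a - l) (by omega)
    rw [show l + (a - l) = a by omega, show a + b - l - (a - l) = b by omega] at h
    refine h.smul (sub_nonneg.2 ?_)
    exact_mod_cast (by omega : 2 * l ≤ a + b)
  · rw [← Finset.sum_range_add_sum_Ico _ (show b ≤ a + 1 by omega),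
      sum_Ico_elem_mul_eq_zero, add_zero]
    have e : (((a : ℚ) + 1) * b) • (elem a * elem b) =
        ∑ l ∈ range b, (((a + b : ℕ) : ℚ) - 2 * l) • (elem a * elem b) := by
      rw [← Finset.sum_smul, sum_range_sub_two_mul]
      congr 1
      push_cast
      ring
    rw [e, ← Finset.sum_sub_distrib]
    refine isSchurPositive_sum _ _ fun l hl => ?_
    rw [mem_range] at hl
    rw [← smul_sub]
    have h := isSchurPositive_elem_mul_sub (i := l) (j := a + b - l) (by omega) (b - l) (by omega)
    rw [show l + (b - l) = b by omega, show a + b - l - (b - l) = a by omega,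
      mul_comm (elem b)] at h
    refine h.smul (sub_nonneg.2 ?_)
    exact_mod_cast (by omega : 2 * l ≤ a + b)

/-! ### Positivity from the path recursion. -/

section Recursion

variable {P : ℕ → Series}
  (hP : ∀ N, ∑ l ∈ range (N + 1), shiftedElem l * P (N - l) = -elem N)

theorem shiftedElem_zero : shiftedElem 0 = -1 := by
  simp [shiftedElem, elem_zero]

/-- The multiple of `2 X_{K_a} X_{P_{N - a}} - X_{L_{a, N - a}}` whose Schur-positivity is the
core of the comparison of lollipops, if `P` is the sequence of the functions of the paths. -/
def cliquePathDiff (P : ℕ → Series) (a N : ℕ) : Series :=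
  (2 * a : ℚ) • (elem a * P (N - a)) + ∑ j ∈ range a, shiftedElem j * P (N - j)

/-- The coefficients of the power series `A` for which `∑ cliquePathDiff P a N X ^ N = A * P`. -/
def cliquePathWeight (a j : ℕ) : Series :=
  if j < a then shiftedElem j else if j = a then (2 * a : ℚ) • elem a else 0

theorem sum_cliquePathWeight (a N : ℕ) (h : a ≤ N) (G : ℕ → Series) :
    ∑ j ∈ range (N + 1), cliquePathWeight a j * G (N - j) =
      (2 * a : ℚ) • (elem a * G (N - a)) + ∑ j ∈ range a, shiftedElem j * G (N - j) := by
  rw [← Finset.sum_range_add_sum_Ico _ (show a ≤ N + 1 by omega), Finset.sum_eq_sum_Ico_succ_bot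
    (show a < N + 1 by omega), Finset.sum_eq_zero (s := Ico (a + 1) (N + 1))]
  · rw [add_zero, add_comm]
    congr 1
    · simp [cliquePathWeight]
    · exact Finset.sum_congr rfl fun j hj => by
        rw [cliquePathWeight, if_pos (mem_range.1 hj)]
  · intro j hj
    rw [mem_Ico] at hj
    rw [cliquePathWeight, if_neg (by omega), if_neg (by omega), zero_mul]

-- With generating functions `S`, `P`, `E`, `A` of `shiftedElem`, `P`, `elem` and the weights, `S P
-- = -E` gives `S (A P) = -A E`; this is its coefficient of degree `N`.
include hP in
theorem cliquePath_recursion (a N : ℕ) :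
    ∑ k ∈ range (N + 1), shiftedElem k *
        (∑ j ∈ range (N - k + 1), cliquePathWeight a j * P (N - k - j)) =
      -∑ j ∈ range (N + 1), cliquePathWeight a j * elem (N - j) := by
  have h1 : PowerSeries.mk shiftedElem * PowerSeries.mk P = -PowerSeries.mk elem := by
    ext1 n
    rw [PowerSeries.coeff_mul, Finset.Nat.sum_antidiagonal_eq_sum_range_succ_mk]
    simpa using hP n
  have h2 : PowerSeries.mk shiftedElem * (PowerSeries.mk (cliquePathWeight a) * PowerSeries.mk P)
      = -(PowerSeries.mk (cliquePathWeight a) * PowerSeries.mk elem) := by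
    rw [mul_left_comm, h1, mul_neg]
  have h3 := congrArg (PowerSeries.coeff N) h2
  simpa only [PowerSeries.coeff_mul, Finset.Nat.sum_antidiagonal_eq_sum_range_succ_mk, map_neg,
    PowerSeries.coeff_mk] using h3

-- Below degree `a` the weights coincide with `shiftedElem`, so the path recursion itself applies.
include hP in
theorem sum_cliquePathWeight_of_lt (a N : ℕ) (h : N < a) :
    ∑ j ∈ range (N + 1), cliquePathWeight a j * P (N - j) = -elem N := by
  rw [← hP N]
  refine Finset.sum_congr rfl fun j hj => ?_
  rw [mem_range] at hj
  rw [cliquePathWeight, if_pos (by omega)]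

include hP in
theorem path_zero : P 0 = 1 := by
  simpa [shiftedElem_zero, elem_zero] using hP 0

include hP in
theorem cliquePathDiff_self (a : ℕ) : cliquePathDiff P a a = (a : ℚ) • elem a := by
  have h := hP a
  rw [Finset.sum_range_succ, Nat.sub_self, path_zero hP, mul_one] at h
  rw [cliquePathDiff, eq_sub_of_add_eq h, Nat.sub_self, path_zero hP, mul_one, shiftedElem]
  module

include hP in
/-- The recursion for `cliquePathDiff`. -/
theorem cliquePathDiff_eq (a b : ℕ) (hb : 0 < b) :
    cliquePathDiff P a (a + b) =
      ((((a : ℚ) + 1) * b) • (elem a * elem b) -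
      ∑ l ∈ range (a + 1), (((a + b : ℕ) : ℚ) - 2 * l) • (elem l * elem (a + b - l))) +
      ∑ l ∈ Ico (a + 1) (a + b), shiftedElem (a + b - l) * cliquePathDiff P a l := by
  set T : ℕ → Series := fun N => ∑ j ∈ range (N + 1), cliquePathWeight a j * P (N - j) with hT
  have hTge : ∀ N, a ≤ N → T N = cliquePathDiff P a N := fun N h => sum_cliquePathWeight a N h P
  have hTlt : ∀ N, N < a → T N = -elem N := sum_cliquePathWeight_of_lt hP a
  have hrec : ∑ k ∈ range (a + b + 1), shiftedElem k * T (a + b - k) =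
      -∑ j ∈ range (a + b + 1), cliquePathWeight a j * elem (a + b - j) :=
    cliquePath_recursion hP a (a + b)
  rw [sum_cliquePathWeight a _ (by omega)] at hrec
  rw [← Finset.sum_range_reflect] at hrec
  have e1 : ∑ j ∈ range (a + b + 1), shiftedElem (a + b + 1 - 1 - j) *
      T (a + b - (a + b + 1 - 1 - j)) =
      ∑ j ∈ range (a + b + 1), shiftedElem (a + b - j) * T j := by
    refine Finset.sum_congr rfl fun j hj => ?_
    rw [mem_range] at hj
    rw [Nat.add_sub_cancel, Nat.sub_sub_self (by omega)]
  rw [e1, Finset.sum_range_succ, Nat.sub_self, shiftedElem_zero, neg_one_mul, hTge _ (by omega),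
    ← Finset.sum_range_add_sum_Ico _ (show a + 1 ≤ a + b by omega), Finset.sum_range_succ _ a,
    hTge _ le_rfl, cliquePathDiff_self hP, Nat.add_sub_cancel_left] at hrec
  have e2 : ∑ l ∈ Ico (a + 1) (a + b), shiftedElem (a + b - l) * T l =
      ∑ l ∈ Ico (a + 1) (a + b), shiftedElem (a + b - l) * cliquePathDiff P a l :=
    Finset.sum_congr rfl fun l hl => by rw [hTge l (by rw [mem_Ico] at hl; omega)]
  -- For `l < a` both sides of the recursion contribute to `e_l e_{a+b-l}`; the coefficients
  -- `-(a+b-l-1)` and `l-1` add up to `-(a+b-2l)`.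
  have e3 : ∑ l ∈ range a, shiftedElem (a + b - l) * T l +
      ∑ l ∈ range a, shiftedElem l * elem (a + b - l) =
      -∑ l ∈ range a, (((a + b : ℕ) : ℚ) - 2 * l) • (elem l * elem (a + b - l)) := by
    rw [← Finset.sum_add_distrib, ← Finset.sum_neg_distrib]
    refine Finset.sum_congr rfl fun l hl => ?_
    rw [mem_range] at hl
    rw [hTlt l hl, shiftedElem, shiftedElem, smul_mul_assoc, smul_mul_assoc, mul_neg,
      mul_comm (elem (a + b - l))]
    push_cast [show l ≤ a + b by omega]
    module
  rw [e2] at hrec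
  rw [Finset.sum_range_succ _ a, Nat.add_sub_cancel_left]
  have e4 : shiftedElem b * (a : ℚ) • elem a = ((b - 1 : ℚ) * a) • (elem a * elem b) := by
    rw [shiftedElem, smul_mul_smul_comm, mul_comm (elem b)]
  rw [e4] at hrec
  have e5 : cliquePathDiff P a (a + b) = ∑ l ∈ range a, shiftedElem (a + b - l) * T l +
      ((b - 1 : ℚ) * a) • (elem a * elem b) +
      ∑ l ∈ Ico (a + 1) (a + b), shiftedElem (a + b - l) * cliquePathDiff P a l +
      ((2 * a : ℚ) • (elem a * elem b) + ∑ l ∈ range a, shiftedElem l * elem (a + b - l)) := by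
    rw [← sub_eq_zero, ← neg_eq_zero, ← sub_eq_zero.2 hrec]
    abel
  rw [e5]
  -- The coefficients of `e_a e_b` match because `(b-1)a + 2a = (a+1)b - (b-a)`, where `b - a` is
  -- the term `l = a` of the quadratic sum.
  have e6 := eq_sub_of_add_eq e3
  rw [e6]
  push_cast
  module

-- Every `l` in `cliquePathDiff_eq` is less than `N`, so its factor `N - l - 1` is nonnegative.
include hP in
theorem isSchurPositive_cliquePathDiff (a N : ℕ) (h : a < N) :
    IsSchurPositive (cliquePathDiff P a N) := by
  induction N using Nat.strong_induction_on with
  | _ N ih =>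
    obtain ⟨b, rfl⟩ := Nat.exists_eq_add_of_lt h
    rw [add_assoc, cliquePathDiff_eq hP a (b + 1) (by omega)]
    refine (isSchurPositive_quadratic a (b + 1)).add (isSchurPositive_sum _ _ fun l hl => ?_)
    rw [mem_Ico] at hl
    rw [shiftedElem, smul_mul_assoc]
    refine ((ih l (by omega) (by omega)).elem_mul _).smul (sub_nonneg.2 ?_)
    exact_mod_cast (by omega : 1 ≤ a + (b + 1) - l)

include hP in
theorem isSchurPositive_path (N : ℕ) : IsSchurPositive (P N) := by
  induction N using Nat.strong_induction_on with
  | _ N ih =>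
    have h := hP N
    rw [Finset.sum_range_succ', Nat.sub_zero, shiftedElem_zero, neg_one_mul] at h
    have h' : P N = ∑ l ∈ range N, shiftedElem (l + 1) * P (N - (l + 1)) + elem N := by
      rw [eq_add_of_add_neg_eq h]; abel
    rw [h']
    refine (isSchurPositive_sum _ _ fun l hl => ?_).add (isSchurPositive_elem N)
    rw [mem_range] at hl
    rw [shiftedElem, smul_mul_assoc]
    refine ((ih _ (by omega)).elem_mul _).smul ?_
    push_cast
    simp

end Recursion

/-! ### Algebraic independence of the elementary symmetric functions. -/

open Classical in
theorem elem_apply (k : ℕ) (d : ℕ →₀ ℕ) :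
    MvPowerSeries.coeff d (elem k) = if (∀ i, d i ≤ 1) ∧ d.degree = k then 1 else 0 :=
  rfl

theorem degree_embDomain {σ τ : Type*} (e : σ ↪ τ) (x : σ →₀ ℕ) :
    (Finsupp.embDomain e x).degree = x.degree := by
  simp [Finsupp.degree_apply, Finsupp.support_embDomain]

theorem sum_single_one_apply {σ : Type*} [DecidableEq σ] (t : Finset σ) (i : σ) :
    (∑ j ∈ t, Finsupp.single j 1 : σ →₀ ℕ) i = if i ∈ t then 1 else 0 := by
  rw [Finsupp.finsetSum_apply]
  simp [Finsupp.single_apply]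

theorem degree_eq_card_support {σ : Type*} (x : σ →₀ ℕ) (hx : ∀ i, x i ≤ 1) :
    x.degree = #x.support := by
  rw [Finsupp.degree_apply, Finset.card_eq_sum_ones]
  refine Finset.sum_congr rfl fun i hi => ?_
  have := hx i
  have := Finsupp.mem_support_iff.1 hi
  omega

theorem sum_single_one_eq_iff {σ : Type*} (t : Finset σ) (x : σ →₀ ℕ) :
    ∑ j ∈ t, Finsupp.single j 1 = x ↔ (∀ i, x i ≤ 1) ∧ t = x.support := by
  classical
  constructor
  · rintro rfl
    refine ⟨fun i => ?_, ?_⟩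
    · rw [sum_single_one_apply]; split_ifs <;> simp
    · ext i
      rw [Finsupp.mem_support_iff, sum_single_one_apply]
      simp
  · rintro ⟨h, rfl⟩
    ext i
    rw [sum_single_one_apply]
    have := h i
    split_ifs with hi
    · have := Finsupp.mem_support_iff.1 hi
      omega
    · exact (Finsupp.notMem_support_iff.1 hi).symm

theorem killCompl_elem (n k : ℕ) :
    MvPowerSeries.killCompl (Fin.valEmbedding (n := n)) (elem k) =
      (MvPolynomial.esymm (Fin n) ℚ k : MvPowerSeries (Fin n) ℚ) := by
  classical
  ext1 x
  rw [MvPowerSeries.coeff_killCompl, elem_apply, MvPolynomial.coeff_coe,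
    MvPolynomial.esymm_eq_sum_monomial, MvPolynomial.coeff_sum]
  simp only [MvPolynomial.coeff_monomial, sum_single_one_eq_iff, degree_embDomain]
  have h1 : (∀ i, (Finsupp.embDomain (Fin.valEmbedding (n := n)) x) i ≤ 1) ↔ ∀ i, x i ≤ 1 := by
    refine ⟨fun h i => ?_, fun h i => ?_⟩
    · simpa only [Finsupp.embDomain_apply_self] using h (Fin.valEmbedding i)
    · by_cases hi : i ∈ Set.range (Fin.valEmbedding (n := n))
      · obtain ⟨j, rfl⟩ := hi
        simpa only [Finsupp.embDomain_apply_self] using h j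
      · rw [Finsupp.embDomain_of_notMem_range _ _ _ hi]; simp
  rw [h1]
  by_cases hx : ∀ i, x i ≤ 1
  · simp only [hx, implies_true, true_and, degree_eq_card_support x hx]
    simp [Finset.sum_ite_eq', mem_powersetCard]
  · simp [hx]

/-- Polynomials in `e_1, e_2, …`. -/
def elemAlgHom : MvPolynomial ℕ ℚ →ₐ[ℚ] Series := MvPolynomial.aeval fun k => elem (k + 1)

/-- A polynomial involves only finitely many `e_k`. Setting all but the first `n` variables to zero
reduces to the algebraic independence of `e_1, …, e_n` in `n` variables. -/
theorem elemAlgHom_injective : Function.Injective elemAlgHom := by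
  rw [injective_iff_map_eq_zero]
  intro p hp
  obtain ⟨n, hn⟩ : ∃ n, ∀ i ∈ p.vars, i < n := ⟨p.vars.sup id + 1, fun i hi =>
    Nat.lt_succ_of_le (Finset.le_sup (f := id) hi)⟩
  obtain ⟨q, rfl⟩ := MvPolynomial.exists_rename_eq_of_vars_subset_range p
    (Fin.val : Fin n → ℕ) Fin.val_injective (fun i hi => ⟨⟨i, hn i hi⟩, rfl⟩)
  have h1 : MvPowerSeries.killCompl (Fin.valEmbedding (n := n))
      (elemAlgHom (MvPolynomial.rename Fin.val q)) =
      MvPolynomial.coeToMvPowerSeries.algHom ℚ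
        (MvPolynomial.aeval (fun i : Fin n => MvPolynomial.esymm (Fin n) ℚ (i + 1)) q) := by
    rw [elemAlgHom, MvPolynomial.aeval_rename, ← AlgHom.comp_apply, ← AlgHom.comp_apply]
    congr 1
    refine MvPolynomial.algHom_ext fun i => ?_
    simp [killCompl_elem]
  rw [hp, map_zero] at h1
  have h2 : MvPolynomial.aeval (fun i : Fin n => MvPolynomial.esymm (Fin n) ℚ (i + 1)) q = 0 := by
    refine MvPolynomial.coe_injective (Fin n) ℚ ?_
    simpa using h1.symm
  have h3 : q = 0 := by
    refine MvPolynomial.esymmAlgHom_fin_injective ℚ (le_refl n) (Subtype.ext ?_)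
    rw [MvPolynomial.esymmAlgHom_apply, h2, map_zero]
    rfl
  rw [h3, map_zero]

/-! ### Reading off the coefficient of `s_(1^N)`. -/

/-- The homomorphism `e_k ↦ X ^ k`. -/
def columnAlgHom : MvPolynomial ℕ ℚ →ₐ[ℚ] Polynomial ℚ :=
  MvPolynomial.aeval fun k => Polynomial.X ^ (k + 1)

/-- `F` is a polynomial in the elementary symmetric functions, which becomes `q` under
`e_k ↦ X ^ k`. -/
def HasColumnSeries (F : Series) (q : Polynomial ℚ) : Prop :=
  ∃ p, elemAlgHom p = F ∧ columnAlgHom p = q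

theorem HasColumnSeries.add {F G : Series} {q r : Polynomial ℚ} (hF : HasColumnSeries F q)
    (hG : HasColumnSeries G r) : HasColumnSeries (F + G) (q + r) := by
  obtain ⟨p, rfl, rfl⟩ := hF
  obtain ⟨p', rfl, rfl⟩ := hG
  exact ⟨p + p', map_add _ _ _, map_add _ _ _⟩

theorem HasColumnSeries.mul {F G : Series} {q r : Polynomial ℚ} (hF : HasColumnSeries F q)
    (hG : HasColumnSeries G r) : HasColumnSeries (F * G) (q * r) := by
  obtain ⟨p, rfl, rfl⟩ := hF
  obtain ⟨p', rfl, rfl⟩ := hG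
  exact ⟨p * p', map_mul _ _ _, map_mul _ _ _⟩

theorem HasColumnSeries.smul {F : Series} {q : Polynomial ℚ} (hF : HasColumnSeries F q) (a : ℚ) :
    HasColumnSeries (a • F) (a • q) := by
  obtain ⟨p, rfl, rfl⟩ := hF
  exact ⟨a • p, map_smul _ _ _, map_smul _ _ _⟩

theorem hasColumnSeries_zero : HasColumnSeries 0 0 := ⟨0, map_zero _, map_zero _⟩

theorem hasColumnSeries_sum {ι : Type*} (s : Finset ι) (F : ι → Series) (q : ι → Polynomial ℚ)
    (h : ∀ i ∈ s, HasColumnSeries (F i) (q i)) :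
    HasColumnSeries (∑ i ∈ s, F i) (∑ i ∈ s, q i) := by
  classical
  induction s using Finset.induction_on with
  | empty => simpa using hasColumnSeries_zero
  | insert a s ha ih =>
    rw [Finset.sum_insert ha, Finset.sum_insert ha]
    exact (h a (mem_insert_self _ _)).add (ih fun i hi => h i (mem_insert_of_mem hi))

theorem hasColumnSeries_elem (k : ℕ) : HasColumnSeries (elem k) (Polynomial.X ^ k) := by
  cases k with
  | zero => exact ⟨1, by rw [map_one, elem_zero], by rw [map_one, pow_zero]⟩
  | succ k => exact ⟨MvPolynomial.X k, by simp [elemAlgHom], by simp [columnAlgHom]⟩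

theorem hasColumnSeries_elemInt (m : ℤ) :
    HasColumnSeries (elemInt m) (if 0 ≤ m then Polynomial.X ^ m.toNat else 0) := by
  cases m with
  | ofNat k =>
    rw [if_pos (show (0 : ℤ) ≤ Int.ofNat k from Int.natCast_nonneg k)]
    exact hasColumnSeries_elem k
  | negSucc k =>
    rw [if_neg (by simp)]
    exact hasColumnSeries_zero

theorem hasColumnSeries_schur (μ : YoungDiagram) :
    HasColumnSeries (schur μ) (Matrix.det (Matrix.of fun i j : Fin (μ.rowLen 0) =>
      if 0 ≤ (μ.colLen i : ℤ) - ((i : ℕ) : ℤ) + ((j : ℕ) : ℤ) then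
        (Polynomial.X : Polynomial ℚ) ^ ((μ.colLen i : ℤ) - ((i : ℕ) : ℤ) + ((j : ℕ) : ℤ)).toNat
      else 0)) := by
  choose p hp hp' using hasColumnSeries_elemInt
  refine ⟨Matrix.det (Matrix.of fun i j : Fin (μ.rowLen 0) =>
    p ((μ.colLen i : ℤ) - ((i : ℕ) : ℤ) + ((j : ℕ) : ℤ))), ?_, ?_⟩
  · rw [AlgHom.map_det, schur]
    congr 1
    ext1 i j
    simp [hp]
  · rw [AlgHom.map_det]
    congr 1
    ext1 i j
    simp only [AlgHom.mapMatrix_apply, Matrix.map_apply, Matrix.of_apply]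
    exact hp' _

theorem mem_column {n : ℕ} {c : ℕ × ℕ} : c ∈ column n ↔ c.1 < n ∧ c.2 = 0 := by
  rw [← YoungDiagram.mem_cells, column, mem_product, mem_range, mem_singleton]

theorem colLen_column_zero (n : ℕ) : (column n).colLen 0 = n := by
  refine Nat.le_antisymm (le_of_forall_lt fun i hi => ?_) (le_of_forall_lt fun i hi => ?_)
  · rw [← YoungDiagram.mem_iff_lt_colLen, mem_column] at hi
    exact hi.1
  · rw [← YoungDiagram.mem_iff_lt_colLen, mem_column]
    exact ⟨hi, rfl⟩

theorem eq_column_colLen {μ : YoungDiagram} (h : μ.rowLen 0 ≤ 1) : μ = column (μ.colLen 0) := by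
  refine SetLike.ext fun c => ?_
  obtain ⟨i, j⟩ := c
  rw [mem_column]
  constructor
  · intro hc
    have h1 : j < μ.rowLen i := YoungDiagram.mem_iff_lt_rowLen.1 hc
    have h2 := μ.rowLen_anti 0 i (Nat.zero_le _)
    obtain rfl : j = 0 := by omega
    exact ⟨YoungDiagram.mem_iff_lt_colLen.1 hc, rfl⟩
  · rintro ⟨h1, h2⟩
    dsimp only at h1 h2
    subst h2
    exact YoungDiagram.mem_iff_lt_colLen.2 h1

theorem rowLen_column_le (n : ℕ) : (column n).rowLen 0 ≤ 1 := by
  by_contra h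
  have := mem_column.1 (YoungDiagram.mem_iff_lt_rowLen.2 (not_le.1 h))
  simp at this

theorem hasColumnSeries_schur_column (n : ℕ) :
    HasColumnSeries (schur (column n)) (Polynomial.X ^ n) := by
  have h : schur (column n) = elem n := by
    rw [← jacobiTrudi_colLen (rowLen_column_le n), jacobiTrudi, Matrix.det_fin_one]
    simp [colLen_column_zero, elemInt_natCast]
  rw [h]
  exact hasColumnSeries_elem n

/-- Under `e_k ↦ X^k` the first two rows of the Jacobi–Trudi matrix become proportional. -/
theorem hasColumnSeries_schur_of_two_le {μ : YoungDiagram} (h : 2 ≤ μ.rowLen 0) :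
    HasColumnSeries (schur μ) 0 := by
  have h0 := hasColumnSeries_schur μ
  set M := (Matrix.of fun i j : Fin (μ.rowLen 0) =>
      if 0 ≤ (μ.colLen i : ℤ) - ((i : ℕ) : ℤ) + ((j : ℕ) : ℤ) then
        (Polynomial.X : Polynomial ℚ) ^ ((μ.colLen i : ℤ) - ((i : ℕ) : ℤ) + ((j : ℕ) : ℤ)).toNat
      else 0) with hM
  -- This keeps all indices in the second row nonnegative; a negative one would give the entry `0`
  -- and break proportionality.
  have hpos : 0 < μ.colLen 1 := YoungDiagram.mem_iff_lt_colLen.1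
    (YoungDiagram.mem_iff_lt_rowLen.2 (by omega))
  have hle := μ.colLen_anti 0 1 (by omega)
  set i0 : Fin (μ.rowLen 0) := ⟨0, by omega⟩ with hi0
  set i1 : Fin (μ.rowLen 0) := ⟨1, by omega⟩ with hi1
  have hne : i0 ≠ i1 := by simp [hi0, hi1]
  have hrow : M i0 = (Polynomial.X : Polynomial ℚ) ^ (μ.colLen 0 - μ.colLen 1 + 1) • M i1 := by
    funext j
    simp only [hM, Matrix.of_apply, Pi.smul_apply, smul_eq_mul, hi0, hi1]
    rw [if_pos (by omega), if_pos (by omega), ← pow_add]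
    congr 1
    omega
  have hdet : M.det = 0 := by
    rw [← Matrix.updateRow_eq_self M i0, hrow, Matrix.det_updateRow_smul,
      Matrix.det_updateRow_eq_zero hne.symm, mul_zero]
  rwa [hdet] at h0

theorem exists_hasColumnSeries_schur (μ : YoungDiagram) :
    ∃ q, HasColumnSeries (schur μ) q ∧ ∀ N, q.coeff N = Finsupp.single μ 1 (column N) := by
  classical
  rcases Nat.lt_or_ge 1 (μ.rowLen 0) with h | h
  · refine ⟨0, hasColumnSeries_schur_of_two_le h, fun N => ?_⟩
    rw [Polynomial.coeff_zero, Finsupp.single_apply, if_neg]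
    rintro rfl
    exact absurd (rowLen_column_le N) (not_le.2 h)
  · rw [eq_column_colLen h]
    refine ⟨_, hasColumnSeries_schur_column _, fun N => ?_⟩
    rw [Polynomial.coeff_X_pow, Finsupp.single_apply]
    refine if_congr ⟨fun e => by rw [e], fun e => ?_⟩ rfl rfl
    rw [← colLen_column_zero N, ← e, colLen_column_zero]

/-- The coefficient of `s_(1^N)` in a Schur expansion is read off from the values `e_k ↦ X ^ k`. -/
theorem schurCoeff_column {F : Series} {q : Polynomial ℚ} (hq : HasColumnSeries F q)
    (hF : IsSchurPositive F) (N : ℕ) : schurCoeff (column N) F = q.coeff N := by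
  have h : ∃ c : YoungDiagram →₀ ℚ, IsSchurExpansion F c := hF.imp fun _ hc => hc.2
  rw [schurCoeff, dif_pos h]
  have hc := h.choose_spec
  set c := h.choose
  rw [IsSchurExpansion] at hc
  choose p hp hp' using exists_hasColumnSeries_schur
  have h1 : HasColumnSeries F (∑ μ ∈ c.support, c μ • p μ) := by
    rw [hc, Finsupp.sum]
    exact hasColumnSeries_sum _ _ _ fun μ _ => (hp μ).smul _
  obtain ⟨a, ha, rfl⟩ := hq
  obtain ⟨b, hb, hb'⟩ := h1
  -- `F` is represented by only one polynomial in the `e_k`, so `q` can be computed from whichever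
  -- Schur expansion was chosen.
  obtain rfl := elemAlgHom_injective (ha.trans hb.symm)
  rw [hb', Polynomial.finsetSum_coeff]
  simp only [Polynomial.coeff_smul, hp', smul_eq_mul]
  conv_lhs => rw [← Finsupp.sum_single c]
  rw [Finsupp.sum, Finsupp.finsetSum_apply]
  refine Finset.sum_congr rfl fun μ _ => ?_
  rw [← mul_one (c μ), ← smul_eq_mul, ← Finsupp.smul_single, Finsupp.smul_apply]
  simp

/-! ### Chromatic symmetric functions of disjoint unions and complete graphs. -/

section Colorings

variable {V W : Type} [Fintype V] [Fintype W]

/-- The exponent of the monomial that a map to the colors contributes. -/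
def content (κ : V → ℕ) : ℕ →₀ ℕ := ∑ v, Finsupp.single (κ v) 1

theorem mem_support_content (κ : V → ℕ) (v : V) : κ v ∈ (content κ).support := by
  rw [Finsupp.mem_support_iff, content, Finsupp.finsetSum_apply]
  exact (Finset.sum_pos' (fun _ _ => Nat.zero_le _) ⟨v, mem_univ v, by simp⟩).ne'

theorem content_comp_equiv (e : V ≃ W) (κ : W → ℕ) : content (κ ∘ e) = content κ :=
  Equiv.sum_comp e fun w => Finsupp.single (κ w) 1

theorem content_sum (κ : V ⊕ W → ℕ) :
    content κ = content (κ ∘ Sum.inl) + content (κ ∘ Sum.inr) :=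
  Fintype.sum_sum_type _

open Classical in
/-- The proper colorings that contribute a given monomial. -/
def properColorings (G : SimpleGraph V) (d : ℕ →₀ ℕ) : Finset (V → ℕ) :=
  (Fintype.piFinset fun _ => d.support).filter fun κ =>
    (∀ v w, G.Adj v w → κ v ≠ κ w) ∧ content κ = d

theorem mem_properColorings {G : SimpleGraph V} {d : ℕ →₀ ℕ} {κ : V → ℕ} :
    κ ∈ properColorings G d ↔ (∀ v w, G.Adj v w → κ v ≠ κ w) ∧ content κ = d := by
  classical
  rw [properColorings, mem_filter, Fintype.mem_piFinset]
  refine ⟨fun h => h.2, fun h => ⟨fun v => ?_, h⟩⟩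
  rw [← h.2]
  exact mem_support_content κ v

theorem coeff_chromaticSymm (G : SimpleGraph V) (d : ℕ →₀ ℕ) :
    MvPowerSeries.coeff d (chromaticSymm G) = #(properColorings G d) := by
  change ((Nat.card _ : ℕ) : ℚ) = _
  rw [Nat.cast_inj, ← Fintype.card_coe, ← Nat.card_eq_fintype_card]
  exact Nat.card_congr
    { toFun := fun κ => ⟨κ.1, mem_properColorings.2 ⟨fun _ _ h => κ.1.valid h, κ.2⟩⟩
      invFun := fun κ => ⟨SimpleGraph.Coloring.mk κ.1 fun h =>
        (mem_properColorings.1 κ.2).1 _ _ h, (mem_properColorings.1 κ.2).2⟩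
      left_inv := fun _ => rfl
      right_inv := fun _ => rfl }

theorem chromaticSymm_congr {G : SimpleGraph V} {H : SimpleGraph W} (e : V ≃ W)
    (h : ∀ v w, H.Adj (e v) (e w) ↔ G.Adj v w) : chromaticSymm G = chromaticSymm H := by
  refine MvPowerSeries.ext fun d => ?_
  rw [coeff_chromaticSymm, coeff_chromaticSymm, Nat.cast_inj]
  refine Finset.card_nbij' (fun κ => κ ∘ e.symm) (fun κ => κ ∘ e) ?_ ?_ ?_ ?_
  · intro κ hκ
    rw [mem_coe, mem_properColorings] at hκ ⊢
    refine ⟨fun v w hvw => hκ.1 _ _ ?_, by rw [content_comp_equiv, hκ.2]⟩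
    rw [← h]
    simpa using hvw
  · intro κ hκ
    rw [mem_coe, mem_properColorings] at hκ ⊢
    exact ⟨fun v w hvw => hκ.1 _ _ ((h v w).2 hvw), by rw [content_comp_equiv, hκ.2]⟩
  · intro κ _
    funext v
    simp
  · intro κ _
    funext v
    simp

theorem chromaticSymm_sum (G : SimpleGraph V) (H : SimpleGraph W) :
    chromaticSymm (G ⊕g H) = chromaticSymm G * chromaticSymm H := by
  classical
  refine MvPowerSeries.ext fun d => ?_
  rw [MvPowerSeries.coeff_mul, coeff_chromaticSymm, Finset.card_eq_sum_card_fiberwise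
    (f := fun κ : V ⊕ W → ℕ => (content (κ ∘ Sum.inl), content (κ ∘ Sum.inr)))
    (t := antidiagonal d)]
  · rw [Nat.cast_sum]
    refine Finset.sum_congr rfl fun x hx => ?_
    rw [HasAntidiagonal.mem_antidiagonal] at hx
    rw [coeff_chromaticSymm, coeff_chromaticSymm, ← Nat.cast_mul, ← Finset.card_product,
      Nat.cast_inj]
    refine Finset.card_nbij' (fun κ => (κ ∘ Sum.inl, κ ∘ Sum.inr)) (fun p => Sum.elim p.1 p.2)
      ?_ ?_ ?_ ?_
    · intro κ hκ
      rw [mem_coe, mem_filter, mem_properColorings] at hκ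
      obtain ⟨⟨h1, -⟩, rfl⟩ := hκ
      rw [mem_coe, mem_product, mem_properColorings, mem_properColorings]
      exact ⟨⟨fun v w h => h1 _ _ (by simpa using h), rfl⟩,
        ⟨fun v w h => h1 _ _ (by simpa using h), rfl⟩⟩
    · rintro ⟨κ, ρ⟩ h
      rw [mem_coe, mem_product, mem_properColorings, mem_properColorings] at h
      obtain ⟨⟨h1, h2⟩, h3, h4⟩ := h
      dsimp only at h1 h2 h3 h4
      rw [mem_coe, mem_filter, mem_properColorings, content_sum]
      simp only [Sum.elim_comp_inl, Sum.elim_comp_inr, h2, h4, hx, and_true]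
      rintro (v | v) (w | w) h
      · exact h1 _ _ (by simpa using h)
      · simp at h
      · simp at h
      · exact h3 _ _ (by simpa using h)
    · intro κ _
      exact Sum.elim_comp_inl_inr κ
    · rintro ⟨κ, ρ⟩ _
      rfl
  · intro κ hκ
    rw [mem_coe, mem_properColorings] at hκ
    rw [mem_coe, HasAntidiagonal.mem_antidiagonal, ← content_sum, hκ.2]

theorem content_of_injective {κ : V → ℕ} (hκ : Function.Injective κ) :
    content κ = ∑ j ∈ univ.map ⟨κ, hκ⟩, Finsupp.single j 1 := by
  rw [Finset.sum_map]
  rfl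

theorem chromaticSymm_top (N : ℕ) :
    chromaticSymm (⊤ : SimpleGraph (Fin N)) = (N.factorial : ℚ) • elem N := by
  classical
  refine MvPowerSeries.ext fun d => ?_
  rw [coeff_chromaticSymm, MvPowerSeries.coeff_smul, elem_apply]
  have hinj : ∀ {κ : Fin N → ℕ}, κ ∈ properColorings ⊤ d → Function.Injective κ := by
    intro κ hκ v w hvw
    by_contra hne
    exact (mem_properColorings.1 hκ).1 v w (by simpa using hne) hvw
  split_ifs with hd
  · obtain ⟨h1, h2⟩ := hd
    have hcard : #d.support = N := by rw [← degree_eq_card_support d h1, h2]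
    rw [mul_one, Nat.cast_inj]
    have h3 : #(univ : Finset (Fin N ↪ d.support)) = N.factorial := by
      rw [Finset.card_univ, Fintype.card_embedding_eq, Fintype.card_fin, Fintype.card_coe, hcard,
        Nat.descFactorial_self]
    rw [← h3]
    symm
    refine Finset.card_bij (fun f _ v => (f v : ℕ)) ?_ ?_ ?_
    · intro f _
      have hf : Function.Injective fun v => (f v : ℕ) :=
        Subtype.val_injective.comp f.injective
      rw [mem_properColorings]
      refine ⟨fun v w h e => (by simpa using h : v ≠ w) (hf e), ?_⟩
      rw [content_of_injective hf, sum_single_one_eq_iff]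
      refine ⟨h1, Finset.eq_of_subset_of_card_le ?_ ?_⟩
      · intro j hj
        obtain ⟨v, -, rfl⟩ := Finset.mem_map.1 hj
        exact (f v).2
      · rw [hcard, Finset.card_map, Finset.card_univ, Fintype.card_fin]
    · intro f _ g _ h
      ext v
      exact congrFun h v
    · intro κ hκ
      refine ⟨⟨fun v => ⟨κ v, ?_⟩, fun v w h => hinj hκ (congrArg Subtype.val h)⟩, mem_univ _,
        rfl⟩
      rw [← (mem_properColorings.1 hκ).2]
      exact mem_support_content κ v
  · rw [mul_zero, Nat.cast_eq_zero, Finset.card_eq_zero, Finset.eq_empty_iff_forall_notMem]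
    intro κ hκ
    have h := (mem_properColorings.1 hκ).2
    rw [content_of_injective (hinj hκ), sum_single_one_eq_iff] at h
    refine hd ⟨h.1, ?_⟩
    rw [degree_eq_card_support d h.1, ← h.2, Finset.card_map, Finset.card_univ, Fintype.card_fin]

end Colorings

/-! ### Lollipops in terms of paths. -/

/-- A clique on `k` vertices and a path on `n + 1` vertices, whose first vertex is joined to the
vertices in `U` of the clique. -/
def joinedCliquePath (k n : ℕ) (U : Finset (Fin k)) : SimpleGraph (Fin k ⊕ Fin (n + 1)) where
  Adj
    | .inl a, .inl b => a ≠ b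
    | .inr i, .inr j => (SimpleGraph.pathGraph (n + 1)).Adj i j
    | .inl a, .inr j => a ∈ U ∧ j = 0
    | .inr j, .inl a => a ∈ U ∧ j = 0
  symm := ⟨by
    rintro (a | a) (b | b) h
    · exact Ne.symm h
    · exact h
    · exact h
    · exact SimpleGraph.Adj.symm h⟩
  loopless := ⟨by
    rintro (a | a) h
    · exact h rfl
    · exact SimpleGraph.irrefl _ h⟩

theorem properColorings_joinedCliquePath (k n : ℕ) (U : Finset (Fin k)) (d : ℕ →₀ ℕ) :
    properColorings (joinedCliquePath k n U) d =
      {κ ∈ properColorings ((⊤ : SimpleGraph (Fin k)) ⊕g SimpleGraph.pathGraph (n + 1)) d |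
        ∀ u ∈ U, κ (.inl u) ≠ κ (.inr 0)} := by
  ext κ
  rw [mem_filter, mem_properColorings, mem_properColorings]
  constructor
  · rintro ⟨h1, h2⟩
    refine ⟨⟨?_, h2⟩, fun u hu => h1 (.inl u) (.inr 0) ⟨hu, rfl⟩⟩
    rintro (v | v) (w | w) h
    · exact h1 (.inl v) (.inl w) (SimpleGraph.sum_adj_inl.1 h :)
    · simp at h
    · simp at h
    · exact h1 (.inr v) (.inr w) (SimpleGraph.sum_adj_inr.1 h :)
  · rintro ⟨⟨h1, h2⟩, h3⟩
    refine ⟨?_, h2⟩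
    rintro (v | v) (w | w) h
    · exact h1 (.inl v) (.inl w) (SimpleGraph.sum_adj_inl.2 h)
    · obtain ⟨h, rfl⟩ := h
      exact h3 v h
    · obtain ⟨h, rfl⟩ := h
      exact (h3 w h).symm
    · exact h1 (.inr v) (.inr w) (SimpleGraph.sum_adj_inr.2 h)

/-- A proper coloring of a clique and a path gives the color of the first vertex of the path to
at most one vertex of the clique. -/
theorem sum_chromaticSymm_joinedCliquePath (k n : ℕ) :
    ∑ u : Fin k, chromaticSymm (joinedCliquePath k n {u}) +
        chromaticSymm ((⊤ : SimpleGraph (Fin k)) ⊕g SimpleGraph.pathGraph (n + 1)) =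
      (k : ℚ) • chromaticSymm ((⊤ : SimpleGraph (Fin k)) ⊕g SimpleGraph.pathGraph (n + 1)) +
        chromaticSymm (joinedCliquePath k n univ) := by
  refine MvPowerSeries.ext fun d => ?_
  simp only [map_add, map_sum, MvPowerSeries.coeff_smul, coeff_chromaticSymm,
    properColorings_joinedCliquePath, mem_singleton, forall_eq, mem_univ, true_imp_iff]
  set S := properColorings ((⊤ : SimpleGraph (Fin k)) ⊕g SimpleGraph.pathGraph (n + 1)) d with hS
  -- Each coloring counts equally on both sides: `k + 1` if no clique vertex has the color of the
  -- first path vertex, and `(k - 1) + 1 = k + 0` if exactly one has.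
  have key : ∑ u : Fin k, #{κ ∈ S | κ (.inl u) ≠ κ (.inr 0)} + #S =
      k * #S + #{κ ∈ S | ∀ u : Fin k, κ (.inl u) ≠ κ (.inr 0)} := by
    simp only [Finset.card_filter]
    rw [Finset.sum_comm, Finset.card_eq_sum_ones, ← Finset.sum_add_distrib, Finset.mul_sum,
      ← Finset.sum_add_distrib]
    refine Finset.sum_congr rfl fun κ hκ => ?_
    have hinj : ∀ u v : Fin k, κ (.inl u) = κ (.inl v) → u = v := by
      intro u v h
      by_contra hne
      exact (mem_properColorings.1 hκ).1 (.inl u) (.inl v) (by simpa using hne) h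
    by_cases h : ∀ u : Fin k, κ (.inl u) ≠ κ (.inr 0)
    · simp [h]
    · rw [if_neg h]
      push Not at h
      obtain ⟨u, hu⟩ := h
      have e : ∀ v : Fin k, (if κ (.inl v) ≠ κ (.inr 0) then 1 else 0) + (if v = u then 1 else 0)
          = 1 := by
        intro v
        by_cases hv : v = u
        · simp [hv, hu]
        · rw [if_pos, if_neg hv]
          rw [← hu]
          exact fun h' => hv (hinj _ _ h')
      have e' := Finset.sum_congr (rfl : (univ : Finset (Fin k)) = univ) fun v _ => e v
      rw [Finset.sum_add_distrib, Finset.sum_ite_eq'] at e'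
      simpa using e'
  exact_mod_cast key

/-- The chromatic symmetric function of the lollipop. -/
def lollipopX (m n : ℕ) : Series := chromaticSymm (lollipop m n)

/-- The chromatic symmetric function of the path. -/
def pathX (N : ℕ) : Series := chromaticSymm (SimpleGraph.pathGraph N)

/-- All clique vertices are equivalent; a transposition moves `u` to the last position, where the
tail of the lollipop is attached. -/
theorem joinedCliquePath_singleton {k : ℕ} (n : ℕ) (u : Fin k) :
    chromaticSymm (joinedCliquePath k n {u}) = lollipopX k (n + 1) := by
  have hk : 0 < k := u.pos
  refine chromaticSymm_congr
    (((Equiv.swap u ⟨k - 1, by omega⟩).sumCongr (Equiv.refl _)).trans finSumFinEquiv) ?_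
  have hs : ∀ a : Fin k, (Equiv.swap u ⟨k - 1, by omega⟩ a : ℕ) + 1 = k ↔ a = u := by
    intro a
    constructor
    · intro h
      apply (Equiv.swap u (⟨k - 1, by omega⟩ : Fin k)).injective
      rw [Equiv.swap_apply_left, Fin.ext_iff]
      dsimp only
      omega
    · rintro rfl
      rw [Equiv.swap_apply_left]
      dsimp only
      omega
  rintro (a | i) (b | j)
  · have ha := (Equiv.swap u ⟨k - 1, by omega⟩ a).2
    have hb := (Equiv.swap u ⟨k - 1, by omega⟩ b).2
    have : a ≠ b ↔ (Equiv.swap u ⟨k - 1, by omega⟩ a) ≠ (Equiv.swap u ⟨k - 1, by omega⟩ b) :=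
      (Equiv.swap u _).injective.ne_iff.symm
    simp only [joinedCliquePath, lollipop, Equiv.trans_apply, Equiv.sumCongr_apply, Sum.map_inl,
      finSumFinEquiv_apply_left, Fin.val_castAdd, ne_eq, Fin.ext_iff] at this ⊢
    omega
  · have ha := (Equiv.swap u ⟨k - 1, by omega⟩ a).2
    have := hs a
    simp only [joinedCliquePath, lollipop, Equiv.trans_apply, Equiv.sumCongr_apply, Sum.map_inl,
      Sum.map_inr, Equiv.refl_apply, finSumFinEquiv_apply_right, Fin.val_natAdd, mem_singleton,
      finSumFinEquiv_apply_left, Fin.val_castAdd, ne_eq, Fin.ext_iff, Fin.val_zero] at this ⊢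
    omega
  · have hb := (Equiv.swap u ⟨k - 1, by omega⟩ b).2
    have := hs b
    simp only [joinedCliquePath, lollipop, Equiv.trans_apply, Equiv.sumCongr_apply, Sum.map_inl,
      Sum.map_inr, Equiv.refl_apply, finSumFinEquiv_apply_right, Fin.val_natAdd, mem_singleton,
      finSumFinEquiv_apply_left, Fin.val_castAdd, ne_eq, Fin.ext_iff, Fin.val_zero] at this ⊢
    omega
  · simp only [joinedCliquePath, lollipop, Equiv.trans_apply, Equiv.sumCongr_apply,
      Sum.map_inr, Equiv.refl_apply, finSumFinEquiv_apply_right, Fin.val_natAdd,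
      SimpleGraph.pathGraph_adj, ne_eq, Fin.ext_iff]
    omega

theorem joinedCliquePath_univ (k n : ℕ) :
    chromaticSymm (joinedCliquePath k n univ) = lollipopX (k + 1) n := by
  refine chromaticSymm_congr (finSumFinEquiv.trans (finCongr (by omega))) ?_
  rintro (a | i) (b | j)
  · simp only [joinedCliquePath, lollipop, Equiv.trans_apply,
      finSumFinEquiv_apply_left, Fin.val_castAdd, ne_eq, Fin.ext_iff, finCongr_apply, Fin.val_cast]
    omega
  · simp only [joinedCliquePath, lollipop, Equiv.trans_apply, finSumFinEquiv_apply_right,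
      Fin.val_natAdd, mem_univ, true_and, Fin.val_zero,
      finSumFinEquiv_apply_left, Fin.val_castAdd, ne_eq, Fin.ext_iff, finCongr_apply, Fin.val_cast]
    omega
  · simp only [joinedCliquePath, lollipop, Equiv.trans_apply, finSumFinEquiv_apply_right,
      Fin.val_natAdd, mem_univ, true_and, Fin.val_zero,
      finSumFinEquiv_apply_left, Fin.val_castAdd, ne_eq, Fin.ext_iff, finCongr_apply, Fin.val_cast]
    omega
  · simp only [joinedCliquePath, lollipop, Equiv.trans_apply, finSumFinEquiv_apply_right,
      Fin.val_natAdd, SimpleGraph.pathGraph_adj, ne_eq, Fin.ext_iff, finCongr_apply, Fin.val_cast]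
    omega

theorem lollipopX_recursion (k n : ℕ) :
    lollipopX (k + 1) n = (k : ℚ) • lollipopX k (n + 1) -
      (((k : ℚ) - 1) * k.factorial) • (elem k * pathX (n + 1)) := by
  have h := sum_chromaticSymm_joinedCliquePath k n
  simp only [joinedCliquePath_singleton, joinedCliquePath_univ, chromaticSymm_sum,
    chromaticSymm_top, Finset.sum_const, Finset.card_univ, Fintype.card_fin, smul_mul_assoc] at h
  rw [← Nat.cast_smul_eq_nsmul ℚ] at h
  rw [eq_sub_of_add_eq' h.symm, pathX]
  module

theorem lollipopX_one (n : ℕ) : lollipopX 1 n = pathX (n + 1) := by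
  refine chromaticSymm_congr (finCongr (by omega)) fun i j => ?_
  simp only [lollipop, SimpleGraph.pathGraph_adj, finCongr_apply, Fin.val_cast, ne_eq, Fin.ext_iff]
  omega

theorem lollipopX_zero (N : ℕ) : lollipopX N 0 = (N.factorial : ℚ) • elem N := by
  rw [← chromaticSymm_top]
  refine chromaticSymm_congr (finCongr (by omega)) fun i j => ?_
  simp only [lollipop, SimpleGraph.top_adj, finCongr_apply, Fin.ext_iff, Fin.val_cast, ne_eq]
  omega

theorem pathX_zero : pathX 0 = 1 := by
  have h : SimpleGraph.pathGraph 0 = ⊤ := by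
    ext i
    exact i.elim0
  rw [pathX, h, chromaticSymm_top, elem_zero]
  simp

theorem lollipopX_eq_sum (k n : ℕ) :
    lollipopX (k + 1) n =
      -(k.factorial : ℚ) • ∑ j ∈ range (k + 1), shiftedElem j * pathX (k + 1 + n - j) := by
  induction k generalizing n with
  | zero =>
    rw [zero_add, lollipopX_one, Finset.sum_range_one, shiftedElem_zero, Nat.sub_zero, add_comm]
    simp
  | succ k ih =>
    rw [lollipopX_recursion, ih, Finset.sum_range_succ _ (k + 1),
      show k + 1 + (n + 1) = k + 1 + 1 + n by omega, show k + 1 + 1 + n - (k + 1) = n + 1 by omega,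
      Nat.factorial_succ]
    rw [shiftedElem, smul_mul_assoc]
    push_cast
    module

/-- The recursion for the chromatic symmetric functions of paths. -/
theorem pathX_recursion (N : ℕ) :
    ∑ l ∈ range (N + 1), shiftedElem l * pathX (N - l) = -elem N := by
  cases N with
  | zero => simp [shiftedElem_zero, pathX_zero, elem_zero]
  | succ k =>
    -- A lollipop without tail is complete, so its function is also `(k + 1)! e_{k+1}`; comparing
    -- the two expressions gives the path recursion.
    have h := lollipopX_eq_sum k 0
    have hk : (k.factorial : ℚ) ≠ 0 := Nat.cast_ne_zero.2 k.factorial_ne_zero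
    rw [lollipopX_zero, Nat.factorial_succ, mul_comm, Nat.cast_mul, mul_smul, neg_smul, ← smul_neg,
      add_zero] at h
    have h' := smul_right_injective Series hk h
    rw [Finset.sum_range_succ, Nat.sub_self, pathX_zero, mul_one, shiftedElem,
      ← neg_eq_iff_eq_neg.2 h']
    push_cast
    module

theorem isSchurPositive_pathX (N : ℕ) : IsSchurPositive (pathX N) :=
  isSchurPositive_path pathX_recursion N

/-- The path recursion exchanges the sum over `j ≤ k` for the complementary one, whose coefficients
`j - 1` are all nonnegative. -/
theorem lollipopX_eq_sum_Ico (k n : ℕ) :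
    lollipopX (k + 1) n = (k.factorial : ℚ) • (elem (k + 1 + n) +
      ∑ j ∈ Ico (k + 1) (k + 1 + n + 1), shiftedElem j * pathX (k + 1 + n - j)) := by
  have h := pathX_recursion (k + 1 + n)
  rw [← Finset.sum_range_add_sum_Ico _ (show k + 1 ≤ k + 1 + n + 1 by omega)] at h
  rw [lollipopX_eq_sum, eq_sub_of_add_eq h]
  module

theorem isSchurPositive_lollipopX (k n : ℕ) : IsSchurPositive (lollipopX (k + 1) n) := by
  rw [lollipopX_eq_sum_Ico]
  refine ((isSchurPositive_elem _).add (isSchurPositive_sum _ _ fun j hj => ?_)).smul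
    (Nat.cast_nonneg _)
  rw [mem_Ico] at hj
  rw [shiftedElem, smul_mul_assoc]
  refine ((isSchurPositive_pathX _).elem_mul _).smul (sub_nonneg.2 ?_)
  exact_mod_cast (by omega : 1 ≤ j)

/-! ### The coefficients of `s_(1^N)` for paths and lollipops. -/

/-- The number of acyclic orientations of the path on `N` vertices. -/
def pathWeight (N : ℕ) : ℚ := if N = 0 then 1 else 2 ^ (N - 1)

theorem pathWeight_succ (N : ℕ) : pathWeight (N + 1) = 2 ^ N := by simp [pathWeight]

theorem sum_pathWeight (N : ℕ) : ∑ m ∈ range N, pathWeight m = pathWeight (N + 1) - pathWeight N := by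
  induction N with
  | zero => simp [pathWeight]
  | succ N ih =>
    rw [Finset.sum_range_succ, ih, pathWeight_succ, pathWeight_succ, pow_succ]
    ring

theorem pathWeight_recursion (N : ℕ) :
    ∑ m ∈ range N, ((N : ℚ) - 1 - m) * pathWeight m + 1 = pathWeight N := by
  induction N with
  | zero => simp [pathWeight]
  | succ N ih =>
    rw [eq_add_of_sub_eq (sum_pathWeight N).symm, ← ih, Finset.sum_range_succ]
    have : ∑ m ∈ range N, (((N + 1 : ℕ) : ℚ) - 1 - m) * pathWeight m =
        ∑ m ∈ range N, ((N : ℚ) - 1 - m) * pathWeight m + ∑ m ∈ range N, pathWeight m := by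
      rw [← Finset.sum_add_distrib]
      refine Finset.sum_congr rfl fun m _ => ?_
      push_cast
      ring
    rw [this]
    push_cast
    ring

theorem pathX_eq_sum (N : ℕ) :
    pathX N = ∑ m ∈ range N, ((N : ℚ) - 1 - m) • (elem (N - m) * pathX m) + elem N := by
  have h := pathX_recursion N
  rw [← Finset.sum_range_reflect, Finset.sum_range_succ] at h
  simp only [Nat.add_sub_cancel, Nat.sub_self, shiftedElem_zero, Nat.sub_zero, neg_one_mul] at h
  have e : ∑ j ∈ range N, shiftedElem (N - j) * pathX (N - (N - j)) =
      ∑ m ∈ range N, ((N : ℚ) - 1 - m) • (elem (N - m) * pathX m) := by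
    refine Finset.sum_congr rfl fun m hm => ?_
    rw [mem_range] at hm
    rw [Nat.sub_sub_self hm.le, shiftedElem, smul_mul_assoc]
    push_cast [hm.le]
    congr 1
    ring
  rw [e] at h
  rw [eq_add_of_add_neg_eq h]
  abel

theorem hasColumnSeries_pathX (N : ℕ) :
    HasColumnSeries (pathX N) (pathWeight N • Polynomial.X ^ N) := by
  induction N using Nat.strong_induction_on with
  | _ N ih =>
    have h1 : pathWeight N • (Polynomial.X : Polynomial ℚ) ^ N = ∑ m ∈ range N,
        ((N : ℚ) - 1 - m) • (Polynomial.X ^ (N - m) * (pathWeight m • Polynomial.X ^ m)) +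
          Polynomial.X ^ N := by
      rw [← pathWeight_recursion N, add_smul, one_smul, Finset.sum_smul]
      congr 1
      refine Finset.sum_congr rfl fun m hm => ?_
      rw [mul_smul_comm, ← pow_add, Nat.sub_add_cancel (mem_range.1 hm).le, smul_smul]
    rw [h1, pathX_eq_sum]
    exact (hasColumnSeries_sum _ _ _ fun m hm =>
      ((hasColumnSeries_elem _).mul (ih m (mem_range.1 hm))).smul _).add (hasColumnSeries_elem N)

theorem hasColumnSeries_lollipopX (k n : ℕ) :
    HasColumnSeries (lollipopX (k + 1) n)
      (((k + 1).factorial * 2 ^ n : ℚ) • Polynomial.X ^ (k + 1 + n)) := by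
  induction k generalizing n with
  | zero =>
    rw [zero_add, lollipopX_one, add_comm 1 n]
    have h := hasColumnSeries_pathX (n + 1)
    rw [pathWeight_succ] at h
    simpa using h
  | succ k ih =>
    -- In `lollipopX_recursion` the scalars combine as `(k+1)! 2^n (2(k+1) - k) = (k+2)! 2^n`.
    have h := ((ih (n + 1)).smul ((k + 1 : ℕ) : ℚ)).add
      (((hasColumnSeries_elem (k + 1)).mul (hasColumnSeries_pathX (n + 1))).smul
        (-((((k + 1 : ℕ) : ℚ) - 1) * (k + 1).factorial)))
    rw [neg_smul, ← sub_eq_add_neg, ← lollipopX_recursion, pathWeight_succ, mul_smul_comm,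
      ← pow_add, smul_smul, smul_smul, ← add_smul] at h
    convert h using 2
    · rw [Nat.factorial_succ (k + 1)]
      push_cast
      ring
    · congr 1
      omega

theorem schurCoeff_lollipopX (k n : ℕ) :
    schurCoeff (column (k + 1 + n)) (lollipopX (k + 1) n) = (k + 1).factorial * 2 ^ n := by
  rw [schurCoeff_column (hasColumnSeries_lollipopX k n) (isSchurPositive_lollipopX k n)]
  simp

/-- The coefficient of `s_(1^(m + n))` in `X_{L_{m,n}}`, for `m ≥ 1`. -/
def lollipopWeight (m n : ℕ) : ℚ := m.factorial * 2 ^ n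

theorem lollipopWeight_pos (m n : ℕ) : 0 < lollipopWeight m n := by
  unfold lollipopWeight
  positivity

/-! ### Comparison of lollipops. -/

theorem isSchurPositive_lollipopX_sub (k n : ℕ) (hk : 1 ≤ k) :
    IsSchurPositive (lollipopX k (n + 1) -
      (lollipopWeight k (n + 1) / lollipopWeight (k + 1) n) • lollipopX (k + 1) n) := by
  obtain ⟨j, rfl⟩ := Nat.exists_eq_add_of_le' hk
  have h := isSchurPositive_cliquePathDiff pathX_recursion (j + 1) (j + 1 + (n + 1)) (by omega)
  -- With `k = j + 1` the weight ratio is `2/(k+1)`, and eliminating `L_{k+1,n}` leaves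
  -- `(k-1)/(k+1)` times `2 k! e_k P_{n+1} - X_{L_{k,n+1}}`. The latter is `(k-1)!` times
  -- `cliquePathDiff`.
  have hc : (0 : ℚ) ≤ (j / (j + 2)) * j.factorial := by positivity
  convert h.smul hc using 1
  have e : ∑ i ∈ range (j + 1), shiftedElem i * pathX (j + 1 + (n + 1) - i) =
      -((j.factorial : ℚ)⁻¹) • lollipopX (j + 1) (n + 1) := by
    rw [lollipopX_eq_sum, smul_smul, neg_mul_neg, inv_mul_cancel₀, one_smul]
    exact Nat.cast_ne_zero.2 j.factorial_ne_zero
  have hj : (j.factorial : ℚ) ≠ 0 := Nat.cast_ne_zero.2 j.factorial_ne_zero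
  have hj2 : (j : ℚ) + 2 ≠ 0 := by positivity
  have hw : lollipopWeight (j + 1) (n + 1) / lollipopWeight (j + 1 + 1) n = 2 / (j + 2) := by
    have hj1 : (j : ℚ) + 1 ≠ 0 := by positivity
    rw [lollipopWeight, lollipopWeight, Nat.factorial_succ (j + 1), Nat.factorial_succ j]
    push_cast
    field_simp
    ring
  rw [hw, cliquePathDiff, e, lollipopX_recursion (j + 1) n, Nat.add_sub_cancel_left, Nat.factorial_succ]
  push_cast
  match_scalars
  · field_simp
    ring
  · field_simp
    ring

theorem IsSchurPositive.sub_trans {F G H : Series} {f g h : ℚ} (hf : 0 < f) (hg : 0 < g)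
    (hFG : IsSchurPositive (F - (f / g) • G)) (hGH : IsSchurPositive (G - (g / h) • H)) :
    IsSchurPositive (F - (f / h) • H) := by
  convert hFG.add (hGH.smul (div_pos hf hg).le) using 1
  rw [smul_sub, smul_smul, div_mul_div_cancel₀ hg.ne']
  abel

theorem isSchurPositive_lollipopX_sub_add (k n d : ℕ) (hk : 1 ≤ k) :
    IsSchurPositive (lollipopX k (n + d) -
      (lollipopWeight k (n + d) / lollipopWeight (k + d) n) • lollipopX (k + d) n) := by
  induction d generalizing n with
  | zero =>
    rw [add_zero, add_zero, div_self (lollipopWeight_pos _ _).ne', one_smul, sub_self]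
    exact isSchurPositive_zero
  | succ d ih =>
    have h := ih (n + 1)
    rw [add_right_comm, add_assoc] at h
    exact h.sub_trans (lollipopWeight_pos _ _) (lollipopWeight_pos _ _)
      (isSchurPositive_lollipopX_sub (k + d) n (by omega))

theorem schurCoeff_column_lollipopX {N m n : ℕ} (hm : 1 ≤ m) (h : m + n = N) :
    schurCoeff (column N) (lollipopX m n) = lollipopWeight m n := by
  obtain ⟨k, rfl⟩ := Nat.exists_eq_add_of_le' hm
  rw [← h]
  exact schurCoeff_lollipopX k n

/-- Lollipops with smaller cliques are larger. -/
theorem lollipopClass_le {N m n m' n' : ℕ} (hm : 1 ≤ m) (h : m + n = N) (hm' : 1 ≤ m')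
    (h' : m' + n' = N) (hle : m ≤ m') : lollipopClass m' n' hm' h' ≤ lollipopClass m n hm h := by
  change IsSchurPositive (lollipopX m n -
    (schurCoeff (column N) (lollipopX m n) / schurCoeff (column N) (lollipopX m' n')) •
      lollipopX m' n')
  rw [schurCoeff_column_lollipopX hm h, schurCoeff_column_lollipopX hm' h']
  obtain ⟨d, rfl⟩ := Nat.exists_eq_add_of_le hle
  obtain rfl : n = n' + d := by omega
  exact isSchurPositive_lollipopX_sub_add m n' d hm

theorem pathClass_eq (N : ℕ) (hN : 1 ≤ N) :
    pathClass N hN = lollipopClass 1 (N - 1) le_rfl (by omega) := by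
  refine Quotient.sound ?_
  change pathX N = lollipopX 1 (N - 1)
  rw [lollipopX_one, Nat.sub_add_cancel hN]

theorem completeClass_eq (N : ℕ) (hN : 1 ≤ N) :
    completeClass N hN = lollipopClass N 0 hN rfl := by
  refine Quotient.sound ?_
  change chromaticSymm ⊤ = lollipopX N 0
  rw [lollipopX_zero, chromaticSymm_top]

end ChromaticSchur

end

theorem theorem5 (N : ℕ) (hN : 1 ≤ N) :
    (∀ x ∈ ChromaticSchur.lollipops N, ∀ y ∈ ChromaticSchur.lollipops N, x ≤ y ∨ y ≤ x) ∧
    (∀ (m n : ℕ) (hm : 3 ≤ m) (h : m + n = N),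
      ChromaticSchur.lollipopClass (m - 1) (n + 1) (by omega) (by omega) ≥
        ChromaticSchur.lollipopClass m n (by omega) h) ∧
    IsGreatest (ChromaticSchur.lollipops N) (ChromaticSchur.pathClass N hN) ∧
    IsLeast (ChromaticSchur.lollipops N) (ChromaticSchur.completeClass N hN) := by
  refine ⟨?_, fun m n hm h => ChromaticSchur.lollipopClass_le _ _ _ _ (Nat.sub_le _ _), ?_, ?_⟩
  · rintro _ ⟨m, n, hm, h, rfl⟩ _ ⟨m', n', hm', h', rfl⟩
    rcases le_total m m' with hle | hle
    · exact Or.inr (ChromaticSchur.lollipopClass_le _ _ _ _ hle)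
    · exact Or.inl (ChromaticSchur.lollipopClass_le _ _ _ _ hle)
  · rw [ChromaticSchur.pathClass_eq]
    refine ⟨⟨_, _, _, _, rfl⟩, ?_⟩
    rintro _ ⟨m, n, hm, h, rfl⟩
    exact ChromaticSchur.lollipopClass_le _ _ _ _ hm
  · rw [ChromaticSchur.completeClass_eq]
    refine ⟨⟨_, _, _, _, rfl⟩, ?_⟩
    rintro _ ⟨m, n, hm, h, rfl⟩
    exact ChromaticSchur.lollipopClass_le _ _ _ _ (by omega)
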